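/- Let $G$ be a simply connected nilpotent (real) Lie group of dimension $6$, let $\Gamma\subset G$ be a discrete subgroup such that the quotient $M=\Gamma\backslash G$ is compact, and let $J$ be an invariant complex structure on the nilmanifold $M$, i.e. an integrable complex structure on $M$ induced by a left-invariant one on $G$. Let $g$ be an invariant $J$-Hermitian metric on $M$, i.e. a Riemannian metric with $g(J\cdot,J\cdot)=g(\cdot,\cdot)$ induced by a left-invariant metric on $G$, and let $\Omega(\cdot,\cdot)=g(J\cdot,\cdot)$ be its fundamental $2$-form. Then $g$ is $1$-st Gauduchon, that is $\partial\overline{\partial}\Omega\wedge\Omega=0$, if and only if $g$ is SKT, that is $\partial\overline{\partial}\Omega=0$. -/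

import Mathlib

open scoped Manifold ContDiff
open Bundle

noncomputable section

namespace Nilmanifold

/-- A smooth real Lie group has the smoothness that Mathlib asks for to form its Lie algebra. -/
instance leInfty_minSmoothness_real : ENat.LEInfty (minSmoothness ℝ 3) :=
  ⟨by rw [minSmoothness_of_isRCLikeNormedField]; exact ENat.LEInfty.out⟩

/-! ### Complex-valued differential forms on a real smooth manifold -/

section Forms

variable {E : Type*} [NormedAddCommGroup E] [NormedSpace ℝ E]
  {M : Type*} [TopologicalSpace M] [ChartedSpace E M]

variable (E M) in
/-- Complex-valued differential `k`-forms on the manifold `M` modelled on `E`, as sections of the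
bundle of alternating forms. -/
abbrev DiffForm (k : ℕ) : Type _ :=
  ∀ x : M, (TangentSpace 𝓘(ℝ, E) x) [⋀^Fin k]→L[ℝ] ℂ

/-- The expression of a differential form in the preferred chart around `p`: its pullback by the
inverse of the chart, a form on the open target of the chart in `E`. -/
def inChart {k : ℕ} (η : DiffForm E M k) (p : M) (y : E) : E [⋀^Fin k]→L[ℝ] ℂ :=
  (η ((extChartAt 𝓘(ℝ, E) p).symm y)).compContinuousLinearMap
    (mfderiv 𝓘(ℝ, E) 𝓘(ℝ, E) (extChartAt 𝓘(ℝ, E) p).symm y)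

/-- The exterior derivative on a manifold: at `p`, take the exterior derivative of the expression
of the form in the chart around `p`, and pull it back by the chart. -/
def extD {k : ℕ} (η : DiffForm E M k) : DiffForm E M (k + 1) := fun p =>
  (extDeriv (inChart η p) (extChartAt 𝓘(ℝ, E) p p)).compContinuousLinearMap
    (mfderiv 𝓘(ℝ, E) 𝓘(ℝ, E) (extChartAt 𝓘(ℝ, E) p) p)

theorem extD_const_smul {k : ℕ} (c : ℂ) (η : DiffForm E M k) :
    extD (c • η) = c • extD η := by
  funext p
  have h1 : inChart (c • η) p = c • inChart η p := rfl
  have h2 : extDeriv (c • inChart η p) (extChartAt 𝓘(ℝ, E) p p)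
      = c • extDeriv (inChart η p) (extChartAt 𝓘(ℝ, E) p p) := by
    have h3 : fderiv ℝ (c • inChart η p) (extChartAt 𝓘(ℝ, E) p p)
        = c • fderiv ℝ (inChart η p) (extChartAt 𝓘(ℝ, E) p p) :=
      congrFun (fderiv_const_smul_field (𝕜 := ℝ) (f := inChart η p) c) _
    ext v
    rw [extDeriv, h3]
    simp [extDeriv, ContinuousAlternatingMap.alternatizeUncurryFin_apply, Finset.mul_sum]
  simp only [extD, h1, h2, Pi.smul_apply]
  rfl

/-- The wedge product of two complex-valued alternating forms on a real vector space, normalised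
as a sum over shuffles. -/
def wedge {V : Type*} [AddCommGroup V] [Module ℝ V] {k l : ℕ}
    (a : V [⋀^Fin k]→ₗ[ℝ] ℂ) (b : V [⋀^Fin l]→ₗ[ℝ] ℂ) : V [⋀^Fin (k + l)]→ₗ[ℝ] ℂ :=
  ((LinearMap.mul' ℝ ℂ).compAlternatingMap (a.domCoprod b)).domDomCongr finSumFinEquiv

end Forms

/-! ### Complex structures and the Dolbeault operators -/

section ComplexStructures

variable {E : Type*} [NormedAddCommGroup E] [NormedSpace ℝ E]
  {M : Type*} [TopologicalSpace M] [ChartedSpace E M] [IsManifold 𝓘(ℝ, E) ∞ M]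

variable (E M) in
/-- A complex structure on a real smooth manifold: a smooth endomorphism field `J` of the tangent
bundle with `J² = -1` which is integrable, that is, whose Nijenhuis tensor vanishes. -/
structure ComplexStructure where
  /-- The endomorphism of each tangent space. -/
  J (x : M) : TangentSpace 𝓘(ℝ, E) x →L[ℝ] TangentSpace 𝓘(ℝ, E) x
  J_sq (x : M) (v : TangentSpace 𝓘(ℝ, E) x) : J x (J x v) = -v
  smooth : ContMDiff 𝓘(ℝ, E) (𝓘(ℝ, E).prod 𝓘(ℝ, E →L[ℝ] E)) ∞
    (fun x => TotalSpace.mk' (E →L[ℝ] E)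
      (E := fun x : M => TangentSpace 𝓘(ℝ, E) x →L[ℝ] TangentSpace 𝓘(ℝ, E) x) x (J x))
  integrable (X Y : ∀ x : M, TangentSpace 𝓘(ℝ, E) x)
    (hX : ContMDiff 𝓘(ℝ, E) 𝓘(ℝ, E).tangent ∞ (fun x => (⟨x, X x⟩ : TangentBundle 𝓘(ℝ, E) M)))
    (hY : ContMDiff 𝓘(ℝ, E) 𝓘(ℝ, E).tangent ∞ (fun x => (⟨x, Y x⟩ : TangentBundle 𝓘(ℝ, E) M)))
    (p : M) :
    VectorField.mlieBracket 𝓘(ℝ, E) (fun x => J x (X x)) (fun x => J x (Y x)) p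
      - J p (VectorField.mlieBracket 𝓘(ℝ, E) (fun x => J x (X x)) Y p)
      - J p (VectorField.mlieBracket 𝓘(ℝ, E) X (fun x => J x (Y x)) p)
      - VectorField.mlieBracket 𝓘(ℝ, E) X Y p = 0

namespace ComplexStructure

variable (J : ComplexStructure E M)

/-- The action of `J` on forms, `(Jα)(v₁, …, vₖ) = α(Jv₁, …, Jvₖ)`. -/
def act {k : ℕ} (α : DiffForm E M k) : DiffForm E M k :=
  fun x => (α x).compContinuousLinearMap (J.J x)

/-- The inverse of `act`, `(J⁻¹α)(v₁, …, vₖ) = α(-Jv₁, …, -Jvₖ)`. -/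
def actInv {k : ℕ} (α : DiffForm E M k) : DiffForm E M k :=
  fun x => (α x).compContinuousLinearMap (-(J.J x))

/-- The operator `dᶜ = J⁻¹ d J = i(∂̄ - ∂)`. -/
def dc {k : ℕ} (α : DiffForm E M k) : DiffForm E M (k + 1) :=
  J.actInv (extD (J.act α))

/-- The Dolbeault operator `∂ = (d + i dᶜ)/2`; see `del_eq_and_delbar_eq`. -/
def del {k : ℕ} (α : DiffForm E M k) : DiffForm E M (k + 1) :=
  fun x => (1 / 2 : ℂ) • (extD α x + Complex.I • J.dc α x)

/-- The Dolbeault operator `∂̄ = (d - i dᶜ)/2`; see `del_eq_and_delbar_eq`. -/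
def delbar {k : ℕ} (α : DiffForm E M k) : DiffForm E M (k + 1) :=
  fun x => (1 / 2 : ℂ) • (extD α x - Complex.I • J.dc α x)

/-- Forms of type `(p, q)`: those `(p + q)`-forms which satisfy
`α(z v₁, …, z vₖ) = z ^ p * conj z ^ q * α(v₁, …, vₖ)` for every complex number `z`, where `z` acts
on tangent vectors by `z v = (re z) v + (im z) J v`. -/
def HasType (p q : ℕ) {k : ℕ} (α : DiffForm E M k) : Prop :=
  p + q = k ∧ ∀ (z : ℂ) (x : M) (v : Fin k → TangentSpace 𝓘(ℝ, E) x),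
    α x (fun i => z.re • v i + z.im • J.J x (v i)) = z ^ p * (starRingEnd ℂ z) ^ q * α x v

/-- The operators `∂` and `∂̄` are the components of `d`: if `α` has type `(p, q)` and `dα` is the
sum of a form of type `(p + 1, q)` and a form of type `(p, q + 1)`, these two are `∂α` and `∂̄α`. -/
theorem del_eq_and_delbar_eq {p q k : ℕ} {α : DiffForm E M k} {β γ : DiffForm E M (k + 1)}
    (hα : J.HasType p q α) (hβ : J.HasType (p + 1) q β) (hγ : J.HasType p (q + 1) γ)
    (h : extD α = β + γ) : J.del α = β ∧ J.delbar α = γ := by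
  have hI : ∀ (a b : ℕ) {m : ℕ} {δ : DiffForm E M m}, J.HasType a b δ → ∀ x v,
      δ x (fun i => J.J x (v i)) = Complex.I ^ a * (-Complex.I) ^ b * δ x v := by
    intro a b m δ hδ x v
    have := hδ.2 Complex.I x v
    simpa using this
  have hI' : ∀ (a b : ℕ) {m : ℕ} {δ : DiffForm E M m}, J.HasType a b δ → ∀ x v,
      δ x (fun i => -(J.J x (v i))) = (-Complex.I) ^ a * Complex.I ^ b * δ x v := by
    intro a b m δ hδ x v
    have := hδ.2 (-Complex.I) x v
    simpa using this
  have hact : J.act α = (Complex.I ^ p * (-Complex.I) ^ q) • α := by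
    funext x
    ext v
    exact hI p q hα x v
  have hd : extD (J.act α) = (Complex.I ^ p * (-Complex.I) ^ q) • extD α := by
    rw [hact]
    exact extD_const_smul _ α
  have hII : Complex.I * -Complex.I = 1 := by simp
  have hpq : Complex.I ^ p * (-Complex.I) ^ q * ((-Complex.I) ^ p * Complex.I ^ q) = 1 := by
    rw [mul_mul_mul_comm, ← mul_pow, ← mul_pow, mul_comm (-Complex.I), hII]; simp
  have hdc : ∀ x v, J.dc α x v = -Complex.I * β x v + Complex.I * γ x v := by
    intro x v
    have h1 := hI' _ _ hβ x v
    have h2 := hI' _ _ hγ x v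
    have : J.dc α x v = (Complex.I ^ p * (-Complex.I) ^ q) *
        (β x (fun i => -(J.J x (v i))) + γ x (fun i => -(J.J x (v i)))) := by
      simp only [dc, hd, h]
      rfl
    rw [this, h1, h2]
    linear_combination (-Complex.I * β x v + Complex.I * γ x v) * hpq
  constructor
  · funext x
    ext v
    have e : J.del α x v = (1 / 2 : ℂ) * (extD α x v + Complex.I * J.dc α x v) := rfl
    have e' : extD α x v = β x v + γ x v := by rw [h]; rfl
    rw [e, e', hdc]
    linear_combination (1 / 2 : ℂ) * (γ x v - β x v) * Complex.I_mul_I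
  · funext x
    ext v
    have e : J.delbar α x v = (1 / 2 : ℂ) * (extD α x v - Complex.I * J.dc α x v) := rfl
    have e' : extD α x v = β x v + γ x v := by rw [h]; rfl
    rw [e, e', hdc]
    linear_combination (1 / 2 : ℂ) * (β x v - γ x v) * Complex.I_mul_I

variable (E M) in
/-- A Hermitian metric: a smooth Riemannian metric `g` with `g(Jv, Jw) = g(v, w)`. -/
structure _root_.Nilmanifold.HermitianMetric (J : ComplexStructure E M) extends
    ContMDiffRiemannianMetric 𝓘(ℝ, E) ∞ E (fun x : M => TangentSpace 𝓘(ℝ, E) x) where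
  hermitian (x : M) (v w : TangentSpace 𝓘(ℝ, E) x) : inner x (J.J x v) (J.J x w) = inner x v w

end ComplexStructure

namespace HermitianMetric

variable {J : ComplexStructure E M} (g : HermitianMetric E M J)

theorem inner_J_self (x : M) (v : TangentSpace 𝓘(ℝ, E) x) : g.inner x (J.J x v) v = 0 := by
  have h := g.hermitian x (J.J x v) v
  rw [J.J_sq, map_neg, neg_apply, g.symm x v] at h
  linarith

/-- The fundamental 2-form `Ω(v, w) = g(Jv, w)`, as a complex-valued form. -/
def Omega : DiffForm E M 2 := fun x =>
  { toFun := fun v => ((g.inner x (J.J x (v 0)) (v 1) : ℝ) : ℂ)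
    map_update_add' := by
      intro inst m i v w
      rw [Subsingleton.elim inst (instDecidableEqFin 2)]
      fin_cases i <;> simp
    map_update_smul' := by
      intro inst m i c v
      rw [Subsingleton.elim inst (instDecidableEqFin 2)]
      fin_cases i <;> simp
    map_eq_zero_of_eq' := by
      intro v i j hv hij
      have : v 0 = v 1 := by
        fin_cases i <;> fin_cases j <;> first | exact absurd rfl hij | exact hv | exact hv.symm
      simp only [this, inner_J_self, Complex.ofReal_zero]
    cont := by
      have key : ∀ B : E →L[ℝ] E →L[ℝ] ℝ, Continuous fun v : Fin 2 → E => B (v 0) (v 1) := by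
        intro B
        fun_prop
      exact Complex.continuous_ofReal.comp (key ((g.inner x).comp (J.J x))) }

@[simp]
theorem Omega_apply (x : M) (v : Fin 2 → TangentSpace 𝓘(ℝ, E) x) :
    g.Omega x v = ((g.inner x (J.J x (v 0)) (v 1) : ℝ) : ℂ) := rfl

/-- The metric is SKT (strong Kähler with torsion, pluriclosed): `∂∂̄Ω = 0`. -/
def IsSKT : Prop := J.del (J.delbar g.Omega) = 0

/-- In complex dimension `n = 3`, the metric is 1-st Gauduchon if `∂∂̄Ω ∧ Ω ^ (n - 2) = 0`, that is,
if `∂∂̄Ω ∧ Ω = 0`. -/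
def IsFirstGauduchon : Prop :=
  ∀ x : M, wedge (J.del (J.delbar g.Omega) x).toAlternatingMap (g.Omega x).toAlternatingMap = 0

end HermitianMetric

end ComplexStructures

/-! ### Nilmanifolds and invariant structures -/

section Quotients

variable {E : Type*} [NormedAddCommGroup E] [NormedSpace ℝ E]
  {G : Type*} [Group G] [TopologicalSpace G] [ChartedSpace E G]
  {M : Type*} [TopologicalSpace M] [ChartedSpace E M]

variable (E) in
/-- The map `pr : G → M` presents the smooth manifold `M` as the quotient `Γ \ G` of the Lie group
`G` by the action of the subgroup `Γ` by left translations: it is a surjective local diffeomorphism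
whose fibres are the cosets `Γ a`. -/
structure IsLeftQuotient (Γ : Subgroup G) (pr : G → M) : Prop where
  surjective : Function.Surjective pr
  isLocalDiffeomorph : IsLocalDiffeomorph 𝓘(ℝ, E) 𝓘(ℝ, E) ∞ pr
  eq_iff (a b : G) : pr a = pr b ↔ ∃ γ ∈ Γ, b = γ * a

/-- The image `d(pr)_a(X_a)` in `T_{pr(a)} M` of the value at `a` of the left-invariant vector field `X`
on `G` with value `v` at the identity. -/
def leftField (pr : G → M) (v : GroupLieAlgebra 𝓘(ℝ, E) G) (a : G) :
    TangentSpace 𝓘(ℝ, E) (pr a) :=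
  mfderiv 𝓘(ℝ, E) 𝓘(ℝ, E) pr a (mulInvariantVectorField v a)

variable [IsManifold 𝓘(ℝ, E) ∞ M]

/-- The complex structure on `M = Γ \ G` is invariant: it is induced by a left-invariant
endomorphism field on `G`, the one with value `j` at the identity. -/
def ComplexStructure.IsInvariant (J : ComplexStructure E M) (pr : G → M) : Prop :=
  ∃ j : GroupLieAlgebra 𝓘(ℝ, E) G →ₗ[ℝ] GroupLieAlgebra 𝓘(ℝ, E) G,
    ∀ (a : G) (v : GroupLieAlgebra 𝓘(ℝ, E) G),
      J.J (pr a) (leftField pr v a) = leftField pr (j v) a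

/-- The metric on `M = Γ \ G` is invariant: it is induced by a left-invariant metric on `G`, the one
with value `b` at the identity. -/
def HermitianMetric.IsInvariant {J : ComplexStructure E M} (g : HermitianMetric E M J)
    (pr : G → M) : Prop :=
  ∃ b : GroupLieAlgebra 𝓘(ℝ, E) G →ₗ[ℝ] GroupLieAlgebra 𝓘(ℝ, E) G →ₗ[ℝ] ℝ,
    ∀ (a : G) (v w : GroupLieAlgebra 𝓘(ℝ, E) G),
      g.inner (pr a) (leftField pr v a) (leftField pr w a) = b v w

end Quotients

end Nilmanifold

end

/-! Only the passage from 1-st Gauduchon to SKT has content. Both conditions live on the Lie algebra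
`L` of `G`: invariant vector fields frame the tangent bundle of `M`, and on forms with constant
coefficients in this frame `d` is the Chevalley–Eilenberg differential. There `∂∂̄Ω` becomes a
4-form `Ψ` built from `dJdΩ`, and evaluating `Ψ ∧ Ω` on a unitary basis gives the trace
`Ψ(e₀,e₁,e₂,e₃) + Ψ(e₀,e₁,e₄,e₅) + Ψ(e₂,e₃,e₄,e₅)`. It has to be shown that `Ψ = 0` once this trace
vanishes.

Nilpotency and integrability make `[L,L] + j[L,L]` proper, so a unit vector `x₁` is orthogonal to
it, and the complex orthogonal complement `W` of `x₁` is a four-dimensional `j`-invariant ideal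
containing all brackets.

If `W` is abelian, the trace is, up to a constant factor, minus the sum of the squared norms of the
brackets of `x₁` and `j x₁` with a basis of `W`, plus the traces of `(j ad x₁)²` and `(j ad (j
x₁))²`. Both traces are zero by `trace_comp_ad_sq`. Hence the brackets vanish, `W` is central, and
`Ψ = 0`.

If `W` is not abelian, the same argument inside `W` gives a complex line `Z` containing `[W,W]`.
Since a nilpotent action compatible with `j` on a complex line is trivial (`lie_mem_of_line`), `Z`
turns out to be central in `L` and to contain `[L,L]`. Then `Ψ(e₀,e₁,e₂,e₃)` is the only possibly
nonzero component of `Ψ`, and it equals the trace. -/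

noncomputable section

namespace Nilmanifold

/-! ### Nilpotent Lie algebras with an integrable complex structure -/

section Nilpotent

variable {L : Type*} [LieRing L] [LieAlgebra ℝ L]

/-- The span of the brackets of elements of `S` with elements of `K`. -/
def bracketSpan (S K : Submodule ℝ L) : Submodule ℝ L :=
  Submodule.span ℝ {z | ∃ x ∈ S, ∃ y ∈ K, ⁅x, y⁆ = z}

theorem lie_mem_bracketSpan {S K : Submodule ℝ L} {x y : L} (hx : x ∈ S) (hy : y ∈ K) :
    ⁅x, y⁆ ∈ bracketSpan S K :=
  Submodule.subset_span ⟨x, hx, y, hy, rfl⟩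

/-- An endomorphism of a Lie algebra which is an integrable complex structure. -/
structure IsComplexStructure (j : L →ₗ[ℝ] L) : Prop where
  sq (x : L) : j (j x) = -x
  lie_map_map (x y : L) : ⁅j x, j y⁆ = j ⁅j x, y⁆ + j ⁅x, j y⁆ + ⁅x, y⁆

variable {j : L →ₗ[ℝ] L}

theorem mem_sup_map_iff {S : Submodule ℝ L} {x : L} :
    x ∈ S ⊔ S.map j ↔ ∃ s ∈ S, ∃ t ∈ S, s + j t = x := by
  simp [Submodule.mem_sup]

theorem IsComplexStructure.map_mem_sup_map (hj : IsComplexStructure j) {S : Submodule ℝ L} {x : L}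
    (hx : x ∈ S ⊔ S.map j) : j x ∈ S ⊔ S.map j := by
  obtain ⟨s, hs, t, ht, rfl⟩ := mem_sup_map_iff.1 hx
  exact mem_sup_map_iff.2 ⟨-t, S.neg_mem ht, s, hs, by rw [map_add, hj.sq]; abel⟩

/-- For a nonzero nilpotent Lie subalgebra `K` with an integrable complex structure `j`, the space
`[K, K] + j [K, K]` is a proper subspace of `K`. -/
theorem IsComplexStructure.not_le_bracketSpan_sup_map [LieRing.IsNilpotent L]
    (hj : IsComplexStructure j) {K : Submodule ℝ L} (hK : K ≠ ⊥) (hjK : ∀ x ∈ K, j x ∈ K)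
    (hbr : ∀ x ∈ K, ∀ y ∈ K, ⁅x, y⁆ ∈ K) :
    ¬ K ≤ bracketSpan K K ⊔ (bracketSpan K K).map j := by
  intro hle
  -- If `K ≤ [K,K] + j[K,K]`, then `S` with `K ≤ S + jS` can be replaced by `[S,K]`, one term deeper
  -- in the lower central series, until `S = 0`.
  have key : ∀ n, ∃ S : Submodule ℝ L, S ≤ K ∧
      S ≤ (LieModule.lowerCentralSeries ℝ L L n).toSubmodule ∧ K ≤ S ⊔ S.map j := by
    intro n
    induction n with
    | zero => exact ⟨K, le_rfl, by simp, le_sup_left⟩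
    | succ n ih =>
      obtain ⟨S, hSK, hSn, hKS⟩ := ih
      have hmem : ∀ {z}, z ∈ bracketSpan S K → z ∈ bracketSpan S K ⊔ (bracketSpan S K).map j :=
        fun hz => Submodule.mem_sup_left hz
      have hD : bracketSpan K K ≤ bracketSpan S K ⊔ (bracketSpan S K).map j := by
        refine Submodule.span_le.2 ?_
        rintro _ ⟨x, hx, y, hy, rfl⟩
        obtain ⟨s, hs, t, ht, rfl⟩ := mem_sup_map_iff.1 (hKS hx)
        obtain ⟨s', hs', t', ht', rfl⟩ := mem_sup_map_iff.1 (hKS hy)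
        -- Integrability rewrites `[jt, jt']`, so that each bracket has an entry in `S` itself
        -- rather than in `jS`.
        have h1 : ⁅s + j t, s' + j t'⁆ = ⁅s, s' + j t'⁆ + -⁅s', j t⁆
            + (j (-⁅t', j t⁆) + j ⁅t, j t'⁆ + ⁅t, t'⁆) := by
          rw [lie_skew, lie_skew, ← hj.lie_map_map, add_lie, lie_add, lie_add]; abel
        rw [h1]
        refine add_mem (add_mem (hmem (lie_mem_bracketSpan hs hy)) (neg_mem (hmem
          (lie_mem_bracketSpan hs' (hjK _ (hSK ht)))))) (add_mem (add_mem (hj.map_mem_sup_map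
          (neg_mem (hmem (lie_mem_bracketSpan ht' (hjK _ (hSK ht)))))) (hj.map_mem_sup_map
          (hmem (lie_mem_bracketSpan ht (hjK _ (hSK ht')))))) (hmem (lie_mem_bracketSpan ht
          (hSK ht'))))
      refine ⟨bracketSpan S K, ?_, ?_, hle.trans (sup_le hD ?_)⟩
      · refine Submodule.span_le.2 ?_
        rintro _ ⟨x, hx, y, hy, rfl⟩
        exact hbr _ (hSK hx) _ hy
      · refine Submodule.span_le.2 ?_
        rintro _ ⟨x, hx, y, hy, rfl⟩
        rw [← lie_skew, LieModule.lowerCentralSeries_succ]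
        exact neg_mem (LieSubmodule.lie_mem_lie (LieSubmodule.mem_top y) (hSn hx))
      · refine Submodule.map_le_iff_le_comap.2 fun z hz => hj.map_mem_sup_map (hD hz)
  obtain ⟨k, hk⟩ := LieModule.IsNilpotent.nilpotent ℝ L L
  obtain ⟨S, -, h1, h2⟩ := key k
  rw [hk, LieSubmodule.bot_toSubmodule, le_bot_iff] at h1
  rw [h1] at h2
  exact hK (by simpa using h2)

/-- The quotient by `V` is a complex vector space, so `a + bi` can only kill the class of `v ∉ V` if
it is zero: multiply by the conjugate `a - bi`. -/
theorem IsComplexStructure.eq_zero_of_smul_add_smul_mem (hj : IsComplexStructure j)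
    {V : Submodule ℝ L} (hjV : ∀ x ∈ V, j x ∈ V) {v : L} (hv : v ∉ V) {a b : ℝ}
    (h : a • v + b • j v ∈ V) : a = 0 ∧ b = 0 := by
  have h1 : (a ^ 2 + b ^ 2) • v ∈ V := by
    have : (a ^ 2 + b ^ 2) • v = a • (a • v + b • j v) - b • j (a • v + b • j v) := by
      simp only [map_add, map_smul, hj.sq]
      module
    rw [this]
    exact sub_mem (V.smul_mem _ h) (V.smul_mem _ (hjV _ h))
  have h2 : a ^ 2 + b ^ 2 = 0 := by
    by_contra h0
    exact hv ((V.smul_mem_iff h0).1 h1)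
  constructor <;> nlinarith [sq_nonneg a, sq_nonneg b]

/-- If a nilpotent Lie algebra has an integrable complex structure `j` and `U / V` is a complex line
on which the `j`-invariant subspace `K` acts, then this action is trivial. -/
theorem IsComplexStructure.lie_mem_of_line [LieRing.IsNilpotent L] (hj : IsComplexStructure j)
    {K U V : Submodule ℝ L} (hjK : ∀ x ∈ K, j x ∈ K) (hjU : ∀ x ∈ U, j x ∈ U)
    (hjV : ∀ x ∈ V, j x ∈ V) (u : L)
    (hu : ∀ y ∈ U, ∃ a b : ℝ, y - a • u - b • j u ∈ V)
    (hKU : ∀ x ∈ K, ∀ y ∈ U, ⁅x, y⁆ ∈ U) (hKV : ∀ x ∈ K, ∀ y ∈ V, ⁅x, y⁆ ∈ V) :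
    ∀ x ∈ K, ∀ y ∈ U, ⁅x, y⁆ ∈ V := by
  obtain ⟨k, hk⟩ := LieModule.IsNilpotent.nilpotent ℝ L L
  have hlcs : ∀ (n : ℕ) (x y : L), y ∈ LieModule.lowerCentralSeries ℝ L L n →
      ⁅x, y⁆ ∈ LieModule.lowerCentralSeries ℝ L L (n + 1) := by
    intro n x y hy
    rw [LieModule.lowerCentralSeries_succ]
    exact LieSubmodule.lie_mem_lie (LieSubmodule.mem_top x) hy
  by_cases hUV : U ≤ V
  · exact fun x hx y hy => hKV x hx y (hUV hy)
  -- Engel's argument: otherwise every element of `U` outside `V` is moved by `K` to another such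
  -- element, which yields one in every term of the lower central series.
  obtain ⟨v, hvU, hvV, hv⟩ : ∃ v ∈ U, v ∉ V ∧ ∀ x ∈ K, ⁅x, v⁆ ∈ V := by
    by_contra! hcon
    have : ∀ n, ∃ v ∈ U, v ∉ V ∧ v ∈ LieModule.lowerCentralSeries ℝ L L n := by
      intro n
      induction n with
      | zero =>
        obtain ⟨v, h1, h2⟩ := Set.not_subset.1 hUV
        exact ⟨v, h1, h2, by simp⟩
      | succ n ih =>
        obtain ⟨v, h1, h2, h3⟩ := ih
        obtain ⟨x, hx, hxv⟩ := hcon v h1 h2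
        exact ⟨⁅x, v⁆, hKU x hx v h1, hxv, hlcs n x v h3⟩
    obtain ⟨v, -, h1, h2⟩ := this k
    rw [hk, LieSubmodule.mem_bot] at h2
    exact h1 (h2 ▸ V.zero_mem)
  have hdec : ∀ y ∈ U, ∃ a b : ℝ, y - a • v - b • j v ∈ V := by
    obtain ⟨a, b, hab⟩ := hu v hvU
    have hN : a ^ 2 + b ^ 2 ≠ 0 := by
      intro h0
      have ha : a = 0 := by nlinarith [sq_nonneg a, sq_nonneg b]
      have hb : b = 0 := by nlinarith [sq_nonneg a, sq_nonneg b]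
      subst ha hb
      exact hvV (by simpa using hab)
    intro y hy
    obtain ⟨c, d, hcd⟩ := hu y hy
    -- Modulo `V`, `v` is `(a + bi)u` and `y` is `(c + di)u`; the coefficients are the real and
    -- imaginary parts of `(c + di)/(a + bi)`.
    refine ⟨(c * a + d * b) / (a ^ 2 + b ^ 2), (d * a - c * b) / (a ^ 2 + b ^ 2), ?_⟩
    have : y - ((c * a + d * b) / (a ^ 2 + b ^ 2)) • v - ((d * a - c * b) / (a ^ 2 + b ^ 2)) • j v
        = (y - c • u - d • j u) - ((c * a + d * b) / (a ^ 2 + b ^ 2)) • (v - a • u - b • j u)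
          - ((d * a - c * b) / (a ^ 2 + b ^ 2)) • j (v - a • u - b • j u) := by
      simp only [map_sub, map_smul, hj.sq]
      match_scalars <;> field_simp <;> ring
    rw [this]
    exact sub_mem (sub_mem hcd (V.smul_mem _ hab)) (V.smul_mem _ (hjV _ hab))
  have h1 : ∀ x ∈ K, ∃ c : ℝ, ⁅x, j v⁆ - c • v ∈ V := by
    intro x hx
    obtain ⟨c, d, hcd⟩ := hdec _ (hKU x hx _ (hjU _ hvU))
    suffices d = 0 by
      subst this
      exact ⟨c, by simpa using hcd⟩
    by_contra hd
    -- If `d ≠ 0`, applying `d⁻¹ ad x` repeatedly stays in the form `a v + j v` modulo `V`, so the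
    -- lower central series would never reach zero.
    have : ∀ n, ∃ z ∈ LieModule.lowerCentralSeries ℝ L L n, ∃ a : ℝ, z - a • v - j v ∈ V := by
      intro n
      induction n with
      | zero => exact ⟨j v, by simp, 0, by simp⟩
      | succ n ih =>
        obtain ⟨z, hz, a, ha⟩ := ih
        refine ⟨d⁻¹ • ⁅x, z⁆, Submodule.smul_mem _ _ (hlcs n x z hz), d⁻¹ * c, ?_⟩
        have : d⁻¹ • ⁅x, z⁆ - (d⁻¹ * c) • v - j v = d⁻¹ • (⁅x, z - a • v - j v⁆ + a • ⁅x, v⁆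
            + (⁅x, j v⁆ - c • v - d • j v)) := by
          simp only [lie_sub, lie_smul]
          match_scalars <;> field_simp <;> ring
        rw [this]
        exact V.smul_mem _ (add_mem (add_mem (hKV x hx _ ha) (V.smul_mem _ (hv x hx))) hcd)
    obtain ⟨z, hz, a, ha⟩ := this k
    rw [hk, LieSubmodule.mem_bot] at hz
    subst hz
    have h2 : (-a) • v + (-1 : ℝ) • j v ∈ V := by
      convert ha using 1; module
    have := (hj.eq_zero_of_smul_add_smul_mem hjV hvV h2).2
    norm_num at this
  have h2 : ∀ x ∈ K, ⁅x, j v⁆ ∈ V := by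
    intro x hx
    obtain ⟨c, hc⟩ := h1 x hx
    obtain ⟨d, hd⟩ := h1 (j x) (hjK x hx)
    -- Integrability gives `[jx, jv] ≡ c jv` modulo `V`, while `h1` for `jx` gives `[jx, jv] ≡ d v`;
    -- hence `c = d = 0`.
    have h3 : d • v + (-c) • j v ∈ V := by
      have : d • v + (-c) • j v = -(⁅j x, j v⁆ - d • v) + (j ⁅j x, v⁆ + j (⁅x, j v⁆ - c • v)
          + ⁅x, v⁆) := by
        rw [hj.lie_map_map, map_sub, map_smul]
        module
      rw [this]
      exact add_mem (neg_mem hd) (add_mem (add_mem (hjV _ (hv _ (hjK x hx))) (hjV _ hc)) (hv x hx))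
    have := (hj.eq_zero_of_smul_add_smul_mem hjV hvV h3).2
    have hc0 : c = 0 := by linarith
    simpa [hc0] using hc
  intro x hx y hy
  obtain ⟨a, b, hab⟩ := hdec y hy
  have : ⁅x, y⁆ = ⁅x, y - a • v - b • j v⁆ + a • ⁅x, v⁆ + b • ⁅x, j v⁆ := by
    simp only [lie_sub, lie_smul]; abel
  rw [this]
  exact add_mem (add_mem (hKV x hx _ hab) (V.smul_mem _ (hv x hx))) (V.smul_mem _ (h2 x hx))

open LieAlgebra in
/-- For `x` in a nilpotent Lie algebra with an integrable complex structure `j`, the endomorphism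
`(j ad x)²` has trace zero if `[x, jx]` lies in a `j`-invariant ideal whose elements commute with
it. -/
theorem IsComplexStructure.trace_comp_ad_sq [FiniteDimensional ℝ L] [LieRing.IsNilpotent L]
    (hj : IsComplexStructure j) {W : Submodule ℝ L} (hjW : ∀ x ∈ W, j x ∈ W) (x : L)
    (h1 : ∀ y, ⁅⁅x, j x⁆, y⁆ ∈ W) (h2 : ∀ y ∈ W, ⁅⁅x, j x⁆, y⁆ = 0) :
    LinearMap.trace ℝ L ((j : Module.End ℝ L) * ad ℝ L x * (j * ad ℝ L x)) = 0 := by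
  set A : Module.End ℝ L := ad ℝ L x with hA
  set B : Module.End ℝ L := ad ℝ L (j x) with hB
  let J : Module.End ℝ L := j
  -- Integrability as an identity of endomorphisms. Multiplied by `A` on the right, it expresses
  -- `(JA)²`; as `tr(BJA) = tr(JAB)`, its trace is that of `J ad [x, jx] - A²`.
  have e1 : B * J = A + J * B + J * A * J := by
    ext y
    simp only [Module.End.mul_apply, LinearMap.add_apply, hA, hB, ad_apply, J]
    rw [hj.lie_map_map]; abel
  have e2 : J * A * (J * A) = B * (J * A) - A * A - J * (B * A) := by
    have : B * (J * A) = (B * J) * A := (mul_assoc _ _ _).symm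
    rw [this, e1]; noncomm_ring
  have e3 : ad ℝ L ⁅x, j x⁆ = A * B - B * A := by
    ext y
    simp only [hA, hB, ad_apply, LinearMap.sub_apply, Module.End.mul_apply, lie_lie]
  have n1 : LinearMap.trace ℝ L (A * A) = 0 := by
    obtain ⟨k, hk⟩ := LieAlgebra.nilpotent_ad_of_nilpotent_algebra ℝ L
    have : IsNilpotent (A * A) := by
      refine ⟨k, ?_⟩
      rw [(Commute.refl A).mul_pow, hk x, zero_mul]
    exact (LinearMap.isNilpotent_trace_of_isNilpotent this).eq_zero
  -- `J ad [x, jx]` squares to zero: its image lies in `W`, which `ad [x, jx]` kills.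
  have n2 : LinearMap.trace ℝ L (J * ad ℝ L ⁅x, j x⁆) = 0 := by
    have : IsNilpotent (J * ad ℝ L ⁅x, j x⁆) := by
      refine ⟨2, ?_⟩
      ext y
      simp only [pow_two, Module.End.mul_apply, ad_apply, J, LinearMap.zero_apply]
      rw [h2 _ (hjW _ (h1 y)), map_zero]
    exact (LinearMap.isNilpotent_trace_of_isNilpotent this).eq_zero
  change LinearMap.trace ℝ L (J * A * (J * A)) = 0
  rw [e3, mul_sub, map_sub] at n2
  rw [e2, map_sub, map_sub, n1, LinearMap.trace_mul_comm, mul_assoc, sub_zero]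
  exact n2

end Nilpotent

/-! ### Invariant vector fields on the quotient -/

section InvariantFields

open VectorField Filter Topology

variable {E : Type*} [NormedAddCommGroup E] [NormedSpace ℝ E]
  {G : Type*} [Group G] [TopologicalSpace G] [ChartedSpace E G]
  {M : Type*} [TopologicalSpace M] [ChartedSpace E M]

/-- Left-invariant vector fields on a smooth Lie group are smooth. -/
theorem contMDiff_infty_mulInvariantVectorField [LieGroup 𝓘(ℝ, E) ∞ G]
    (v : GroupLieAlgebra 𝓘(ℝ, E) G) :
    ContMDiff 𝓘(ℝ, E) 𝓘(ℝ, E).tangent ∞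
      (fun a : G => (⟨a, mulInvariantVectorField v a⟩ : TangentBundle 𝓘(ℝ, E) G)) := by
  let fg : G → TangentBundle 𝓘(ℝ, E) G := fun g ↦ TotalSpace.mk' E g 0
  have sfg : ContMDiff 𝓘(ℝ, E) 𝓘(ℝ, E).tangent ∞ fg := contMDiff_zeroSection _ _
  let fv : G → TangentBundle 𝓘(ℝ, E) G := fun _ ↦ TotalSpace.mk' E 1 v
  have sfv : ContMDiff 𝓘(ℝ, E) 𝓘(ℝ, E).tangent ∞ fv := contMDiff_const
  let F₂ : (TangentBundle 𝓘(ℝ, E) G × TangentBundle 𝓘(ℝ, E) G) →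
      TangentBundle (𝓘(ℝ, E).prod 𝓘(ℝ, E)) (G × G) :=
    (equivTangentBundleProd 𝓘(ℝ, E) G 𝓘(ℝ, E) G).symm
  have S₂ : ContMDiff (𝓘(ℝ, E).tangent.prod 𝓘(ℝ, E).tangent)
      (𝓘(ℝ, E).prod 𝓘(ℝ, E)).tangent ∞ F₂ := contMDiff_equivTangentBundleProd_symm
  let F₃ : TangentBundle (𝓘(ℝ, E).prod 𝓘(ℝ, E)) (G × G) → TangentBundle 𝓘(ℝ, E) G :=
    tangentMap (𝓘(ℝ, E).prod 𝓘(ℝ, E)) 𝓘(ℝ, E) (fun (p : G × G) ↦ p.1 * p.2)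
  have S₃ : ContMDiff (𝓘(ℝ, E).prod 𝓘(ℝ, E)).tangent 𝓘(ℝ, E).tangent ∞ F₃ :=
    ContMDiff.contMDiff_tangentMap (contMDiff_mul 𝓘(ℝ, E) ∞) (by simp)
  convert! (S₃.comp S₂).comp (sfg.prodMk sfv) with g
  · simp [F₂, F₃, fg, fv]
  · simp only [Function.comp_apply, tangentMap, F₃, F₂, fg, fv]
    rw [mfderiv_prod_eq_add_apply ((contMDiff_mul 𝓘(ℝ, E) ∞).mdifferentiableAt (by simp))]
    simp +instances only [mulInvariantVectorField]
    exact (((congrArg (· + _) (map_zero (_ : E →L[ℝ] E))).trans (zero_add _))).symm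

variable {Γ : Subgroup G} {pr : G → M}

/-- The vector field on `Γ \ G` induced by the left-invariant vector field on `G` with value `v` at
the identity. -/
def inducedField (hpr : IsLeftQuotient E Γ pr) (v : GroupLieAlgebra 𝓘(ℝ, E) G) (q : M) :
    TangentSpace 𝓘(ℝ, E) q :=
  show E from leftField pr v (Function.surjInv hpr.surjective q)

theorem mulInvariantVectorField_mul_left [LieGroup 𝓘(ℝ, E) ∞ G]
    (v : GroupLieAlgebra 𝓘(ℝ, E) G) (c a : G) :
    mfderiv 𝓘(ℝ, E) 𝓘(ℝ, E) (c * ·) a (mulInvariantVectorField v a)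
      = mulInvariantVectorField v (c * a) := by
  have hd : ∀ c x : G, MDifferentiableAt 𝓘(ℝ, E) 𝓘(ℝ, E) (c * ·) x := fun c x =>
    (contMDiff_mul_left (I := 𝓘(ℝ, E)) (n := ∞)).contMDiffAt.mdifferentiableAt (by simp)
  have h1 : ((c * a) * · : G → G) = (c * ·) ∘ (a * ·) := by
    ext x; simp [mul_assoc]
  -- The base point `a * 1` occurs in the types of the derivative, so it is generalised before being
  -- replaced by `a`.
  have h2 : ∀ y, y = a → (mfderiv 𝓘(ℝ, E) 𝓘(ℝ, E) (c * ·) y : E →L[ℝ] E)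
      = mfderiv 𝓘(ℝ, E) 𝓘(ℝ, E) (c * ·) a := by
    rintro _ rfl; rfl
  simp only [mulInvariantVectorField]
  rw [h1, mfderiv_comp (I' := 𝓘(ℝ, E)) 1 (hd c _) (hd a _)]
  exact (congrArg (fun T : E →L[ℝ] E => T (mfderiv 𝓘(ℝ, E) 𝓘(ℝ, E) (a * ·) 1 v))
    (h2 _ (mul_one a))).symm

theorem IsLeftQuotient.mfderiv_bijective (hpr : IsLeftQuotient E Γ pr) (a : G) :
    Function.Bijective (mfderiv 𝓘(ℝ, E) 𝓘(ℝ, E) pr a) :=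
  ((hpr.isLocalDiffeomorph a).mfderivToContinuousLinearEquiv (by simp)).bijective

/-- Differentiate `pr ∘ (c * ·) = pr`. The two vectors lie over points that are only propositionally
equal, so they are compared in the model space `E`. -/
theorem leftField_mul_left [LieGroup 𝓘(ℝ, E) ∞ G] (hpr : IsLeftQuotient E Γ pr)
    (v : GroupLieAlgebra 𝓘(ℝ, E) G) {c : G} (hc : c ∈ Γ) (a : G) :
    (show E from leftField pr v (c * a)) = leftField pr v a := by
  have h1 : pr ∘ (c * ·) = pr := by
    ext x
    exact ((hpr.eq_iff x (c * x)).2 ⟨c, hc, rfl⟩).symm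
  have hd : ∀ c x : G, MDifferentiableAt 𝓘(ℝ, E) 𝓘(ℝ, E) (c * ·) x := fun c x =>
    (contMDiff_mul_left (I := 𝓘(ℝ, E)) (n := ∞)).contMDiffAt.mdifferentiableAt (by simp)
  have h2 := mfderiv_comp (I := 𝓘(ℝ, E)) (I' := 𝓘(ℝ, E)) (I'' := 𝓘(ℝ, E)) a
    ((hpr.isLocalDiffeomorph (c * a)).mdifferentiableAt (by simp)) (hd c a)
  have h3 : mfderiv 𝓘(ℝ, E) 𝓘(ℝ, E) (pr ∘ (c * ·)) a (mulInvariantVectorField v a)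
      = leftField pr v (c * a) := by
    rw [h2, leftField, ← mulInvariantVectorField_mul_left]
    rfl
  have h4 : ∀ f, f = pr → (mfderiv 𝓘(ℝ, E) 𝓘(ℝ, E) f a : E →L[ℝ] E)
      = mfderiv 𝓘(ℝ, E) 𝓘(ℝ, E) pr a := by
    rintro _ rfl; rfl
  rw [← h3]
  exact congrArg (fun T : E →L[ℝ] E => T (mulInvariantVectorField v a)) (h4 _ h1)

/-- Independence of the chosen preimage. The equality `pr a = q` is a hypothesis so that the lemma
also applies at points `pr (σ q)` for a local section `σ`. -/
theorem inducedField_eq [LieGroup 𝓘(ℝ, E) ∞ G] (hpr : IsLeftQuotient E Γ pr)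
    (v : GroupLieAlgebra 𝓘(ℝ, E) G) {a : G} {q : M} (h : pr a = q) :
    inducedField hpr v q = (show E from leftField pr v a) := by
  subst h
  obtain ⟨c, hc, h⟩ := (hpr.eq_iff a _).1 (Function.surjInv_eq hpr.surjective (pr a)).symm
  rw [inducedField]
  have := leftField_mul_left hpr v hc a
  rw [← h] at this
  exact this

theorem inducedField_apply [LieGroup 𝓘(ℝ, E) ∞ G] (hpr : IsLeftQuotient E Γ pr)
    (v : GroupLieAlgebra 𝓘(ℝ, E) G) (a : G) :
    inducedField hpr v (pr a) = leftField pr v a :=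
  inducedField_eq hpr v rfl

/-- This carries smoothness and brackets from `G` to `M`: both are local and compatible with
pullback by the local inverse of `pr`. -/
theorem eventuallyEq_inducedField [LieGroup 𝓘(ℝ, E) ∞ G] (hpr : IsLeftQuotient E Γ pr)
    (v : GroupLieAlgebra 𝓘(ℝ, E) G) (a : G) :
    inducedField hpr v =ᶠ[𝓝 (pr a)] mpullback 𝓘(ℝ, E) 𝓘(ℝ, E)
      (hpr.isLocalDiffeomorph a).localInverse (mulInvariantVectorField v) := by
  set σ := (hpr.isLocalDiffeomorph a).localInverse with hσ
  have hs : σ.source ∈ 𝓝 (pr a) :=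
    (hpr.isLocalDiffeomorph a).localInverse_open_source.mem_nhds
      (hpr.isLocalDiffeomorph a).localInverse_mem_source
  filter_upwards [hs] with q hq
  have hright : ∀ q ∈ σ.source, pr (σ q) = q := fun q hq =>
    (hpr.isLocalDiffeomorph a).localInverse_right_inv hq
  have hσ' : IsLocalDiffeomorphAt 𝓘(ℝ, E) 𝓘(ℝ, E) ∞ σ q := σ.isLocalDiffeomorphAt _ _ _ hq
  have hcomp : pr ∘ σ =ᶠ[𝓝 q] id := by
    filter_upwards [σ.open_source.mem_nhds hq] with y hy using hright y hy
  have h1 := mfderiv_comp (I := 𝓘(ℝ, E)) (I' := 𝓘(ℝ, E)) (I'' := 𝓘(ℝ, E)) q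
    ((hpr.isLocalDiffeomorph (σ q)).mdifferentiableAt (by simp))
    (hσ'.mdifferentiableAt (by simp))
  rw [hcomp.mfderiv_eq, mfderiv_id] at h1
  have hinv : (mfderiv 𝓘(ℝ, E) 𝓘(ℝ, E) σ q).IsInvertible :=
    ⟨hσ'.mfderivToContinuousLinearEquiv (by simp), rfl⟩
  rw [mpullback_apply, inducedField_eq hpr v (hright q hq)]
  obtain ⟨w, hw⟩ : ∃ w, mfderiv 𝓘(ℝ, E) 𝓘(ℝ, E) σ q w = mulInvariantVectorField v (σ q) :=
    (hσ'.mfderivToContinuousLinearEquiv (by simp)).surjective _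
  rw [leftField, ← hw, hinv.inverse_apply_self]
  exact (congrArg (fun T : E →L[ℝ] E => T w) h1).symm

variable [IsManifold 𝓘(ℝ, E) ∞ M] [CompleteSpace E]

theorem contMDiff_inducedField [LieGroup 𝓘(ℝ, E) ∞ G] (hpr : IsLeftQuotient E Γ pr)
    (v : GroupLieAlgebra 𝓘(ℝ, E) G) :
    ContMDiff 𝓘(ℝ, E) 𝓘(ℝ, E).tangent ∞
      (fun q => (⟨q, inducedField hpr v q⟩ : TangentBundle 𝓘(ℝ, E) M)) := by
  intro q
  obtain ⟨a, rfl⟩ := hpr.surjective q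
  have : IsManifold 𝓘(ℝ, E) ∞ G := inferInstance
  have h1 := (hpr.isLocalDiffeomorph a).localInverse_contMDiffAt
  have h2 : (mfderiv 𝓘(ℝ, E) 𝓘(ℝ, E) (hpr.isLocalDiffeomorph a).localInverse
      (pr a)).IsInvertible :=
    ⟨(hpr.isLocalDiffeomorph a).localInverse_isLocalDiffeomorphAt.mfderivToContinuousLinearEquiv
      (by simp), rfl⟩
  have h3 := ContMDiffAt.mpullback_vectorField_preimage (m := ∞) (n := ∞)
    ((contMDiff_infty_mulInvariantVectorField v).contMDiffAt) h1 h2 (by simp)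
  refine h3.congr_of_eventuallyEq ?_
  filter_upwards [eventuallyEq_inducedField hpr v a] with y hy
  rw [hy]

theorem mlieBracket_inducedField [LieGroup 𝓘(ℝ, E) ∞ G] (hpr : IsLeftQuotient E Γ pr)
    (v w : GroupLieAlgebra 𝓘(ℝ, E) G) :
    mlieBracket 𝓘(ℝ, E) (inducedField hpr v) (inducedField hpr w)
      = inducedField hpr ⁅v, w⁆ := by
  ext q
  obtain ⟨a, rfl⟩ := hpr.surjective q
  have : IsManifold 𝓘(ℝ, E) ∞ G := inferInstance
  have hd : ∀ (v : GroupLieAlgebra 𝓘(ℝ, E) G) x, MDifferentiableAt 𝓘(ℝ, E) 𝓘(ℝ, E).tangent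
      (fun a : G => (⟨a, mulInvariantVectorField v a⟩ : TangentBundle 𝓘(ℝ, E) G)) x :=
    fun v x => (contMDiff_infty_mulInvariantVectorField v).mdifferentiable (by simp) x
  rw [(eventuallyEq_inducedField hpr v a).mlieBracket_vectorField_eq
    (eventuallyEq_inducedField hpr w a), ← mpullback_mlieBracket (n := ∞) (hd v _) (hd w _)
    (hpr.isLocalDiffeomorph a).localInverse_contMDiffAt
    (by rw [minSmoothness_of_isRCLikeNormedField]; exact ENat.LEInfty.out),
    ← mulInvariantVector_mlieBracket, (eventuallyEq_inducedField hpr _ a).self_of_nhds]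
  rfl

end InvariantFields

/-! ### The exterior derivative in a moving frame -/

section Frames

open VectorField Filter Topology

/-- The Chevalley–Eilenberg differential of an `(n + 1)`-cochain `φ`, for the bracket `br`. -/
def ceD {L : Type*} (br : L → L → L) {n : ℕ} (φ : (Fin (n + 1) → L) → ℂ)
    (v : Fin (n + 2) → L) : ℂ :=
  -∑ i : Fin (n + 1), ∑ j ≥ i, (-1) ^ (i + j : ℕ) •
    φ (Matrix.vecCons (br (v i.castSucc) (v j.succ)) (j.removeNth (i.castSucc.removeNth v)))

/-- A form with constant coefficients in a moving frame whose brackets have constant coefficients: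
the exterior derivative is given by the Chevalley–Eilenberg formula. -/
theorem extDeriv_apply_frame {E L : Type*} [NormedAddCommGroup E] [NormedSpace ℝ E]
    [NormedAddCommGroup L] [NormedSpace ℝ L] [CompleteSpace L] {n : ℕ}
    {α : E → E [⋀^Fin (n + 1)]→L[ℝ] ℂ} {F : E → L →L[ℝ] E} {y : E}
    {φ : (Fin (n + 1) → L) → ℂ} {br : L → L → L}
    (hF : DifferentiableAt ℝ F y) (hinv : ∀ᶠ x in 𝓝 y, (F x).IsInvertible)
    (hα : ∀ᶠ x in 𝓝 y, ∀ v : Fin (n + 1) → L, α x (fun i => F x (v i)) = φ v)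
    (hbr : ∀ v w, lieBracket ℝ (F · v) (F · w) y = F y (br v w)) (v : Fin (n + 2) → L) :
    extDeriv α y (fun i => F y (v i)) = ceD br φ v := by
  have hV : ∀ v, DifferentiableAt ℝ (F · v) y := fun v =>
    hF.clm_apply (differentiableAt_const v)
  -- Constancy of the coefficients gives `α x = α y ∘ F y ∘ (F x)⁻¹`, and inversion is
  -- differentiable.
  have hαd : DifferentiableAt ℝ α y := by
    have h1 : DifferentiableAt ℝ (fun x => ((α y).compContinuousLinearMap
        (F y)).compContinuousLinearMap (F x).inverse) y := by
      refine DifferentiableAt.continuousAlternatingMapCompContinuousLinearMap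
        (differentiableAt_const _) ?_
      have := (ContinuousLinearMap.IsInvertible.contDiffAt_map_inverse (n := 1)
        hinv.self_of_nhds).differentiableAt (by simp)
      exact this.comp y hF
    refine h1.congr_of_eventuallyEq ?_
    filter_upwards [hinv, hα] with x hx hx'
    ext u
    have h2 : ∀ i, u i = F x ((F x).inverse (u i)) := fun i => (hx.self_apply_inverse _).symm
    have h3 : (fun i => u i) = fun i => F x ((F x).inverse (u i)) := funext h2
    calc α x u = α x (fun i => F x ((F x).inverse (u i))) := by rw [← h3]
      _ = α y (fun i => F y ((F x).inverse (u i))) := by rw [hx', hα.self_of_nhds]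
      _ = _ := rfl
  have h1 := extDeriv_apply_vectorField (V := fun i x => F x (v i)) hαd (fun i => hV (v i))
  rw [h1, ceD, Finset.sum_eq_zero, zero_sub]
  · congr 1
    refine Finset.sum_congr rfl fun i _ => Finset.sum_congr rfl fun j _ => ?_
    rw [hbr, ← hα.self_of_nhds]
    congr 2
    ext k
    refine Fin.cases ?_ (fun k => ?_) k <;> rfl
  -- The terms differentiating the coefficients of `α` vanish, since these are locally constant.
  · intro i _
    have h2 : (fun x => α x (i.removeNth fun i => F x (v i))) =ᶠ[𝓝 y]
        fun _ => φ (i.removeNth v) := by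
      filter_upwards [hα] with x hx
      exact hx (i.removeNth v)
    rw [h2.fderiv_eq]
    simp

end Frames

theorem differentiableAt_of_clm_apply {D E F : Type*} [NormedAddCommGroup D] [NormedSpace ℝ D]
    [NormedAddCommGroup E] [NormedSpace ℝ E] [FiniteDimensional ℝ E]
    [NormedAddCommGroup F] [NormedSpace ℝ F] {f : D → E →L[ℝ] F} {x : D}
    (h : ∀ w, DifferentiableAt ℝ (f · w) x) : DifferentiableAt ℝ f x := by
  let e₁ := ContinuousLinearEquiv.ofFinrankEq (Module.finrank_fin_fun ℝ (n := Module.finrank ℝ E)).symm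
  let e₂ := (e₁.arrowCongr (1 : F ≃L[ℝ] F)).trans
    (ContinuousLinearEquiv.piRing (Fin (Module.finrank ℝ E)))
  rw [← Function.id_comp f, ← e₂.symm_comp_self]
  exact e₂.symm.differentiable.differentiableAt.comp x (differentiableAt_pi.2 fun i => h _)

/-! ### Invariant forms and the Chevalley–Eilenberg differential -/

section InvariantForms

open VectorField Filter Topology

variable {E : Type*} [NormedAddCommGroup E] [NormedSpace ℝ E]
  {G : Type*} [Group G] [TopologicalSpace G] [ChartedSpace E G]
  {M : Type*} [TopologicalSpace M] [ChartedSpace E M]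
  {Γ : Subgroup G} {pr : G → M}

theorem leftField_add (pr : G → M) (v w : GroupLieAlgebra 𝓘(ℝ, E) G) (a : G) :
    leftField pr (v + w) a = leftField pr v a + leftField pr w a := by
  simp only [leftField, mulInvariantVectorField_add, Pi.add_apply, map_add]

theorem leftField_smul (pr : G → M) (c : ℝ) (v : GroupLieAlgebra 𝓘(ℝ, E) G) (a : G) :
    leftField pr (c • v) a = c • leftField pr v a := by
  simp only [leftField, mulInvariantVectorField_smul, Pi.smul_apply, map_smul]

/-- The evaluation at a point of `G` of the vector fields on `Γ \ G` induced by elements of the Lie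
algebra, as a linear map. -/
def leftFieldₗ (pr : G → M) (a : G) :
    GroupLieAlgebra 𝓘(ℝ, E) G →ₗ[ℝ] TangentSpace 𝓘(ℝ, E) (pr a) where
  toFun v := leftField pr v a
  map_add' v w := leftField_add pr v w a
  map_smul' c v := leftField_smul pr c v a

theorem leftField_neg (pr : G → M) (v : GroupLieAlgebra 𝓘(ℝ, E) G) (a : G) :
    leftField pr (-v) a = -leftField pr v a :=
  (leftFieldₗ (E := E) pr a).map_neg v

variable [FiniteDimensional ℝ E] [LieGroup 𝓘(ℝ, E) ∞ G]

/-- Left translation by `a⁻¹` recovers `v` from the value at `a`, which gives injectivity;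
surjectivity follows because both spaces have underlying space `E`. -/
theorem leftFieldₗ_bijective (hpr : IsLeftQuotient E Γ pr) (a : G) :
    Function.Bijective (leftFieldₗ (E := E) pr a) := by
  have hinj : Function.Injective (leftFieldₗ (E := E) pr a) := by
    intro v w h
    have h1 : mulInvariantVectorField v a = mulInvariantVectorField w a :=
      (hpr.mfderiv_bijective a).1 h
    have h2 : ∀ v : GroupLieAlgebra 𝓘(ℝ, E) G,
        (show E from mulInvariantVectorField v (a⁻¹ * a)) = v := by
      intro v
      have : ∀ b : G, b = 1 → (show E from mulInvariantVectorField v b) = v := by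
        rintro _ rfl
        have h3 : ((1 : G) * · : G → G) = id := by ext; simp
        have h4 : ∀ f : G → G, f = id → (mfderiv 𝓘(ℝ, E) 𝓘(ℝ, E) f 1 : E →L[ℝ] E)
            = mfderiv 𝓘(ℝ, E) 𝓘(ℝ, E) (id : G → G) 1 := by
          rintro _ rfl; rfl
        have h5 := congrArg (fun T : E →L[ℝ] E => T v) (h4 _ h3)
        refine h5.trans ?_
        exact congrArg (fun T : E →L[ℝ] E => T v) mfderiv_id
      exact this _ (inv_mul_cancel a)
    have h3 := mulInvariantVectorField_mul_left v a⁻¹ a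
    have h4 := mulInvariantVectorField_mul_left w a⁻¹ a
    rw [h1, h4] at h3
    exact (h2 v).symm.trans (h3.symm.trans (h2 w))
  exact ⟨hinj, (LinearMap.injective_iff_surjective (K := ℝ) (V := E)).1 hinj⟩

theorem leftField_injective (hpr : IsLeftQuotient E Γ pr) {a : G}
    {v w : GroupLieAlgebra 𝓘(ℝ, E) G} (h : leftField pr v a = leftField pr w a) : v = w :=
  (leftFieldₗ_bijective hpr a).1 h

/-- The form `η` on `Γ \ G` is induced by the left-invariant form on `G` with value `φ` at the
identity. -/
def IsInduced (pr : G → M) {k : ℕ} (η : DiffForm E M k)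
    (φ : (Fin k → GroupLieAlgebra 𝓘(ℝ, E) G) → ℂ) : Prop :=
  ∀ a v, η (pr a) (fun i => leftField pr (v i) a) = φ v

/-- The values at a point of the vector fields on `Γ \ G` induced by elements of the Lie algebra, as
a linear map. -/
def inducedFieldₗ (hpr : IsLeftQuotient E Γ pr) (q : M) :
    GroupLieAlgebra 𝓘(ℝ, E) G →ₗ[ℝ] TangentSpace 𝓘(ℝ, E) q where
  toFun v := inducedField hpr v q
  map_add' v w := by
    obtain ⟨a, rfl⟩ := hpr.surjective q
    simp only [inducedField_apply, leftField_add]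
  map_smul' c v := by
    obtain ⟨a, rfl⟩ := hpr.surjective q
    simp only [inducedField_apply, leftField_smul, RingHom.id_apply]

theorem inducedFieldₗ_bijective (hpr : IsLeftQuotient E Γ pr) (q : M) :
    Function.Bijective (inducedFieldₗ hpr q) := by
  obtain ⟨a, rfl⟩ := hpr.surjective q
  have : inducedFieldₗ hpr (pr a) = leftFieldₗ pr a := by
    ext v
    exact inducedField_apply hpr v a
  rw [this]
  exact leftFieldₗ_bijective hpr a

variable [IsManifold 𝓘(ℝ, E) ∞ M]

/-- The exterior derivative of an invariant form is given by the Chevalley–Eilenberg formula. -/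
theorem IsInduced.extD (hpr : IsLeftQuotient E Γ pr) {n : ℕ} {η : DiffForm E M (n + 1)}
    {φ : (Fin (n + 1) → GroupLieAlgebra 𝓘(ℝ, E) G) → ℂ} (hη : IsInduced pr η φ) :
    IsInduced pr (extD η) (ceD (fun v w => ⁅v, w⁆) φ) := by
  have : CompleteSpace E := FiniteDimensional.complete ℝ E
  have : IsManifold 𝓘(ℝ, E) 2 M := IsManifold.of_le (n := ∞) ENat.LEInfty.out
  intro a v
  set p := pr a with hp
  set ψ := extChartAt 𝓘(ℝ, E) p with hψ
  let S (y : E) : E →L[ℝ] E := mfderivWithin 𝓘(ℝ, E) 𝓘(ℝ, E) ψ.symm (Set.range 𝓘(ℝ, E)) y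
  have hSI : ∀ y ∈ ψ.target, (S y).IsInvertible := fun y hy =>
    isInvertible_mfderivWithin_extChartAt_symm hy
  have hS : ∀ y, S y = mfderiv 𝓘(ℝ, E) 𝓘(ℝ, E) ψ.symm y := by
    intro y
    simp only [S]
    rw [show Set.range 𝓘(ℝ, E) = Set.univ by simp, mfderivWithin_univ]
  let X (q : M) : E →ₗ[ℝ] E := inducedFieldₗ hpr q
  -- The induced fields read in the chart at `p`. In this frame the form has the constant
  -- coefficients `φ` and the brackets have the structure constants of the Lie algebra.
  let F (y : E) : E →L[ℝ] E :=
    LinearMap.toContinuousLinearMap ((S y).inverse.toLinearMap ∘ₗ X (ψ.symm y))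
  have hF : ∀ y w, F y w = (S y).inverse (X (ψ.symm y) w) := fun y w => rfl
  have hF' : ∀ w : E, (F · w) = mpullbackWithin 𝓘(ℝ, E) 𝓘(ℝ, E) ψ.symm (inducedField hpr w)
      (Set.range 𝓘(ℝ, E)) := fun w => rfl
  have htarget : ψ.target ∈ 𝓝 (ψ p) := extChartAt_target_mem_nhds p
  have hFd : DifferentiableAt ℝ F (ψ p) := by
    have h1 : ∀ w : E, DifferentiableAt ℝ (F · w) (ψ p) := by
      intro w
      have h2 := ((contMDiff_inducedField hpr w).mdifferentiable (by simp) p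
        ).mdifferentiableWithinAt (s := Set.univ)
          |>.differentiableWithinAt_mpullbackWithin_vectorField
      have h3 : DifferentiableWithinAt ℝ (F · w)
          (ψ.symm ⁻¹' Set.univ ∩ Set.range 𝓘(ℝ, E)) (ψ p) := h2
      have h4 : ψ.symm ⁻¹' Set.univ ∩ Set.range 𝓘(ℝ, E) = Set.univ := by simp
      rw [h4] at h3
      exact differentiableWithinAt_univ.1 h3
    exact differentiableAt_of_clm_apply h1
  have hinv : ∀ᶠ y in 𝓝 (ψ p), (F y).IsInvertible := by
    filter_upwards [htarget] with y hy
    have hbij : Function.Bijective (F y) := by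
      obtain ⟨e, he⟩ := hSI y hy
      have h1 : ⇑(F y) = e.symm ∘ X (ψ.symm y) := by
        ext w
        rw [hF, ← he, ContinuousLinearMap.inverse_equiv]
        rfl
      rw [h1]
      exact e.symm.bijective.comp (inducedFieldₗ_bijective hpr (ψ.symm y))
    exact ⟨(LinearEquiv.ofBijective (F y).toLinearMap hbij).toContinuousLinearEquiv, by ext; rfl⟩
  have hη' : ∀ (q : M) (w : Fin (n + 1) → E), η q (fun i => X q (w i)) = φ w := by
    intro q w
    obtain ⟨a', rfl⟩ := hpr.surjective q
    rw [← hη a' w]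
    exact congrArg (η (pr a')) (funext fun i => inducedField_apply hpr (w i) a')
  have hφ : ∀ᶠ y in 𝓝 (ψ p), ∀ w : Fin (n + 1) → E,
      inChart η p y (fun i => F y (w i)) = φ w := by
    filter_upwards [htarget] with y hy w
    rw [← hη' (ψ.symm y) w]
    refine congrArg (η (ψ.symm y)) (funext fun i => ?_)
    refine Eq.trans ?_ ((hSI y hy).self_apply_inverse (X (ψ.symm y) (w i)))
    exact (congrArg (fun T : E →L[ℝ] E => T (F y (w i))) (hS y)).symm
  have hSp : S (ψ p) = ContinuousLinearMap.id ℝ E := mfderivWithin_range_extChartAt_symm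
  have hψp : ψ.symm (ψ p) = p := extChartAt_to_inv p
  have hFp : ∀ w : E, F (ψ p) w = inducedField hpr w p := by
    intro w
    rw [hF, hSp, ContinuousLinearMap.inverse_id, hψp]
    rfl
  let br : E → E → E := fun v w =>
    @Bracket.bracket (GroupLieAlgebra 𝓘(ℝ, E) G) (GroupLieAlgebra 𝓘(ℝ, E) G) _ v w
  have hB : ∀ v w : GroupLieAlgebra 𝓘(ℝ, E) G,
      mlieBracketWithin 𝓘(ℝ, E) (inducedField hpr v) (inducedField hpr w) Set.univ p
        = inducedField hpr ⁅v, w⁆ p := by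
    intro v w
    rw [mlieBracketWithin_univ, mlieBracket_inducedField]
  have hid : ∀ (D : E →L[ℝ] E) (x : E), D = ContinuousLinearMap.id ℝ E → D.inverse x = x := by
    rintro _ x rfl
    rw [ContinuousLinearMap.inverse_id]
    rfl
  have hbr : ∀ v w : E, lieBracket ℝ (F · v) (F · w) (ψ p) = F (ψ p) (br v w) := by
    intro v w
    have h0 : (mfderiv 𝓘(ℝ, E) 𝓘(ℝ, E) ψ p : E →L[ℝ] E) = ContinuousLinearMap.id ℝ E :=
      mfderiv_extChartAt_self
    have h1 := hB v w
    rw [mlieBracketWithin_apply] at h1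
    have h2 : lieBracketWithin (E := E) ℝ (F · v) (F · w)
        (ψ.symm ⁻¹' Set.univ ∩ Set.range 𝓘(ℝ, E)) (ψ p) = F (ψ p) (br v w) :=
      (hid _ _ h0).symm.trans (h1.trans (hFp _).symm)
    have h4 : ψ.symm ⁻¹' Set.univ ∩ Set.range 𝓘(ℝ, E) = Set.univ := by simp
    rwa [h4, lieBracketWithin_univ] at h2
  have hpt : ∀ w : E, F (ψ p) w = mfderiv 𝓘(ℝ, E) 𝓘(ℝ, E) ψ p (leftField pr w a) := by
    intro w
    rw [hFp, mfderiv_extChartAt_self]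
    exact inducedField_apply hpr w a
  have key := extDeriv_apply_frame (L := E) hFd hinv hφ hbr v
  refine Eq.trans ?_ key
  refine congrArg (extDeriv (inChart η p) (ψ p)) (funext fun i => ?_)
  exact (hpt (v i)).symm

end InvariantForms

/-! ### Hermitian inner products and unitary bases -/

section Hermitian

open LieAlgebra

variable {L : Type*} [LieRing L] [LieAlgebra ℝ L]

/-- A Hermitian inner product on a Lie algebra with an integrable complex structure. -/
structure IsHermitian (j : L →ₗ[ℝ] L) (b : L →ₗ[ℝ] L →ₗ[ℝ] ℝ) : Prop extends
    IsComplexStructure j where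
  symm (x y : L) : b x y = b y x
  pos (x : L) : x ≠ 0 → 0 < b x x
  map_map (x y : L) : b (j x) (j y) = b x y

variable {j : L →ₗ[ℝ] L} {b : L →ₗ[ℝ] L →ₗ[ℝ] ℝ}

theorem IsHermitian.map_left (h : IsHermitian j b) (x y : L) : b (j x) y = -b x (j y) := by
  rw [← h.map_map x (j y), h.sq, map_neg, neg_neg]

theorem IsHermitian.map_self (h : IsHermitian j b) (x : L) : b x (j x) = 0 := by
  have h1 := h.map_left x x
  rw [h.symm] at h1
  linarith

/-- A proper subspace `V` of `U` has a unit normal vector in `U`. -/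
theorem IsHermitian.exists_unit_normal [FiniteDimensional ℝ L] (h : IsHermitian j b)
    {U V : Submodule ℝ L} (hVU : V ≤ U) (hne : ¬ U ≤ V) :
    ∃ x ∈ U, b x x = 1 ∧ ∀ y ∈ V, b x y = 0 := by
  obtain ⟨u, huU, huV⟩ := Set.not_subset.1 hne
  have hr : b.IsRefl := fun x y hxy => by rw [h.symm, hxy]
  -- Positivity makes `b` nondegenerate on `V`, so the space splits as `V` plus its orthogonal; the
  -- normal is the rescaled orthogonal component of a vector of `U` outside `V`.
  have hnd : (LinearMap.BilinForm.restrict b V).Nondegenerate := by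
    refine ⟨fun x hx => ?_, fun x hx => ?_⟩ <;>
    · by_contra h0
      exact (h.pos x (by simpa using h0)).ne' (hx x)
  have hc := LinearMap.BilinForm.isCompl_orthogonal_of_restrict_nondegenerate hr hnd
  obtain ⟨v, hv, w, hw, hvw⟩ := Submodule.mem_sup.1
    ((hc.sup_eq_top ▸ Submodule.mem_top : u ∈ V ⊔ LinearMap.BilinForm.orthogonal b V))
  have hw0 : w ≠ 0 := by
    rintro rfl
    exact huV (by simpa [← hvw] using hv)
  have hwU : w ∈ U := by
    have : w = u - v := by rw [← hvw]; abel
    rw [this]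
    exact sub_mem huU (hVU hv)
  have hpos := h.pos w hw0
  refine ⟨(Real.sqrt (b w w))⁻¹ • w, U.smul_mem _ hwU, ?_, fun y hy => ?_⟩
  · have := Real.mul_self_sqrt hpos.le
    have h0 : Real.sqrt (b w w) ≠ 0 := (Real.sqrt_pos.2 hpos).ne'
    simp only [map_smul, LinearMap.smul_apply, smul_eq_mul]
    field_simp
    rw [pow_two, this]
  · rw [h.symm, map_smul]
    have : b y w = 0 := hw y hy
    rw [this, smul_zero]

/-- A basis `e₀, j e₀, e₂, j e₂, e₄, j e₄` which is orthonormal. -/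
structure IsUnitaryBasis (j : L →ₗ[ℝ] L) (b : L →ₗ[ℝ] L →ₗ[ℝ] ℝ) (e : Module.Basis (Fin 6) ℝ L) :
    Prop where
  orthonormal (i k : Fin 6) : b (e i) (e k) = if i = k then 1 else 0
  e1 : e 1 = j (e 0)
  e3 : e 3 = j (e 2)
  e5 : e 5 = j (e 4)

theorem IsUnitaryBasis.repr_eq {e : Module.Basis (Fin 6) ℝ L} (he : IsUnitaryBasis j b e)
    (x : L) (i : Fin 6) : e.repr x i = b (e i) x := by
  conv_rhs => rw [← e.sum_repr x, map_sum]
  simp only [map_smul, he.orthonormal, smul_eq_mul, mul_ite, mul_one, mul_zero,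
    Finset.sum_ite_eq, Finset.mem_univ, if_true]

theorem IsUnitaryBasis.trace_eq {e : Module.Basis (Fin 6) ℝ L} (he : IsUnitaryBasis j b e)
    (T : L →ₗ[ℝ] L) : LinearMap.trace ℝ L T = ∑ i, b (e i) (T (e i)) := by
  rw [LinearMap.trace_eq_matrix_trace ℝ e, Matrix.trace]
  simp [LinearMap.toMatrix_apply, he.repr_eq]

/-- The remaining orthogonality relations among the `xᵢ` and `j xᵢ` follow from symmetry and
`j`-invariance; six orthonormal vectors form a basis by dimension. -/
theorem IsHermitian.exists_unitaryBasis (h : IsHermitian j b)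
    (hL : Module.finrank ℝ L = 6) {x₁ x₂ x₃ : L} (h1 : b x₁ x₁ = 1) (h2 : b x₂ x₂ = 1)
    (h3 : b x₃ x₃ = 1) (h12 : b x₁ x₂ = 0) (h12' : b x₁ (j x₂) = 0) (h13 : b x₁ x₃ = 0)
    (h13' : b x₁ (j x₃) = 0) (h23 : b x₂ x₃ = 0) (h23' : b x₂ (j x₃) = 0) :
    ∃ e : Module.Basis (Fin 6) ℝ L, IsUnitaryBasis j b e ∧ e 0 = x₁ ∧ e 2 = x₂ ∧ e 4 = x₃ := by
  let v : Fin 6 → L := ![x₁, j x₁, x₂, j x₂, x₃, j x₃]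
  have hv : ∀ i k, b (v i) (v k) = if i = k then 1 else 0 := by
    have := h.symm
    have := h.map_left
    have := h.map_map
    have := h.map_self
    intro i k
    fin_cases i <;> fin_cases k <;> simp [v] <;> grind
  have hli : LinearIndependent ℝ v := by
    rw [Fintype.linearIndependent_iff]
    intro c hc i
    have := congrArg (b (v i)) hc
    simpa [map_sum, hv] using this
  have hcard : Fintype.card (Fin 6) = Module.finrank ℝ L := by simp [hL]
  refine ⟨basisOfLinearIndependentOfCardEqFinrank hli hcard, ⟨?_, ?_, ?_, ?_⟩, ?_, ?_, ?_⟩ <;>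
    simp [hv, v]

end Hermitian

/-! ### The 4-form `dJdΩ`, and the case of an abelian ideal -/

section Torsion

open LieAlgebra

variable {L : Type*} [LieRing L] [LieAlgebra ℝ L]

/-- The Chevalley–Eilenberg differential of the fundamental form `b (j x) y`. -/
def dFundamental (j : L →ₗ[ℝ] L) (b : L →ₗ[ℝ] L →ₗ[ℝ] ℝ) (x y z : L) : ℝ :=
  -b (j ⁅x, y⁆) z + b (j ⁅x, z⁆) y - b (j ⁅y, z⁆) x

/-- The Chevalley–Eilenberg differential of the 3-form `J dΩ`, where `Ω` is the fundamental form. -/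
def dJdFundamental (j : L →ₗ[ℝ] L) (b : L →ₗ[ℝ] L →ₗ[ℝ] ℝ) (w x y z : L) : ℝ :=
  -dFundamental j b (j ⁅w, x⁆) (j y) (j z) + dFundamental j b (j ⁅w, y⁆) (j x) (j z)
    - dFundamental j b (j ⁅w, z⁆) (j x) (j y) - dFundamental j b (j ⁅x, y⁆) (j w) (j z)
    + dFundamental j b (j ⁅x, z⁆) (j w) (j y) - dFundamental j b (j ⁅y, z⁆) (j w) (j x)

variable {j : L →ₗ[ℝ] L} {b : L →ₗ[ℝ] L →ₗ[ℝ] ℝ}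

/-- Sorting a tuple of distinct basis vectors changes the value of an alternating form only by a
sign. -/
theorem eq_zero_of_strictMono (Ψ : L [⋀^Fin 4]→ₗ[ℝ] ℂ) (e : Module.Basis (Fin 6) ℝ L)
    (h : ∀ t : Fin 4 → Fin 6, StrictMono t → Ψ (fun i => e (t i)) = 0) : Ψ = 0 := by
  refine Module.Basis.ext_alternating e fun t ht => ?_
  have h1 := h (t ∘ Tuple.sort t)
    ((Tuple.monotone_sort t).strictMono_of_injective (ht.comp (Tuple.sort t).injective))
  have h2 := Ψ.map_perm (fun i => e (t i)) (Tuple.sort t)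
  rw [AlternatingMap.zero_apply]
  have h3 : Ψ ((fun i => e (t i)) ∘ Tuple.sort t) = 0 := h1
  rw [h3] at h2
  rcases Int.units_eq_one_or (Equiv.Perm.sign (Tuple.sort t)) with hs | hs <;>
    simpa [hs] using h2.symm

/-- If the brackets lie in an abelian ideal `W`, then `dJdΩ(x, jx, v, jv)` is a sum of squares up to
two trace terms. -/
theorem IsHermitian.dJdFundamental_abelian (h : IsHermitian j b) {W : Submodule ℝ L}
    (hjW : ∀ x ∈ W, j x ∈ W) (hW : ∀ x y : L, ⁅x, y⁆ ∈ W)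
    (hab : ∀ x ∈ W, ∀ y ∈ W, ⁅x, y⁆ = 0) (x : L) {v : L} (hv : v ∈ W) :
    dJdFundamental j b x (j x) v (j v) =
      b v (j ⁅x, j ⁅x, v⁆⁆) + b (j v) (j ⁅x, j ⁅x, j v⁆⁆)
        + b v (j ⁅j x, j ⁅j x, v⁆⁆) + b (j v) (j ⁅j x, j ⁅j x, j v⁆⁆)
        - b ⁅x, v⁆ ⁅x, v⁆ - b ⁅x, j v⁆ ⁅x, j v⁆
        - b ⁅j x, v⁆ ⁅j x, v⁆ - b ⁅j x, j v⁆ ⁅j x, j v⁆ := by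
  -- Only the four summands of `dJdΩ` bracketing one of `x`, `jx` with one of `v`, `jv` survive, and
  -- this formula evaluates them.
  have hτ : ∀ x, ∀ p ∈ W, ∀ q ∈ W,
      dFundamental j b p x q = b (j ⁅x, p⁆) q - b (j ⁅x, q⁆) p := by
    intro x p hp q hq
    rw [dFundamental, hab p hp q hq, ← lie_skew p x]
    simp only [map_zero, map_neg, LinearMap.zero_apply, LinearMap.neg_apply]
    ring
  have hτ0 : ∀ p ∈ W, ∀ q ∈ W, ∀ r ∈ W, dFundamental j b p q r = 0 := by
    intro p hp q hq r hr
    simp [dFundamental, hab p hp q hq, hab p hp r hr, hab q hq r hr]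
  have hjv := hjW v hv
  have hjjv := hjW _ hjv
  have hb : ∀ y z, j ⁅y, z⁆ ∈ W := fun y z => hjW _ (hW y z)
  have e1 : dFundamental j b (j ⁅v, j v⁆) (j x) (j (j x)) = 0 := by
    rw [hab v hv _ hjv]; simp [dFundamental]
  rw [dJdFundamental, hτ0 _ (hb _ _) _ hjv _ hjjv, e1, hτ _ _ (hb _ _) _ hjjv,
    hτ _ _ (hb _ _) _ hjv, hτ _ _ (hb _ _) _ hjjv, hτ _ _ (hb _ _) _ hjv]
  simp only [h.sq, map_neg, neg_lie, lie_neg, LinearMap.neg_apply, h.map_left, h.symm v,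
    neg_neg]
  ring

/-- Adding `dJdFundamental_abelian` for `v = e 2` and `v = e 4` assembles the indefinite terms into
traces of `(j ad x)²` and `(j ad (j x))²`, which vanish. What is left is minus a sum of squares, so
the trace condition makes `e 0` and `e 1` commute with `W`, and `W` is central. -/
theorem IsHermitian.eq_zero_of_abelian [FiniteDimensional ℝ L] [LieRing.IsNilpotent L]
    (h : IsHermitian j b) {e : Module.Basis (Fin 6) ℝ L} (he : IsUnitaryBasis j b e)
    {W : Submodule ℝ L} (hjW : ∀ x ∈ W, j x ∈ W) (hW : ∀ x y : L, ⁅x, y⁆ ∈ W)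
    (hab : ∀ x ∈ W, ∀ y ∈ W, ⁅x, y⁆ = 0) (hmem : ∀ x, x ∈ W ↔ b (e 0) x = 0 ∧ b (e 1) x = 0)
    (Ψ : L [⋀^Fin 4]→ₗ[ℝ] ℂ)
    (hΨ : ∀ v, Ψ v = Complex.I / 4 * ((dJdFundamental j b (v 0) (v 1) (v 2) (v 3)
      + dJdFundamental j b (j (v 0)) (j (v 1)) (j (v 2)) (j (v 3)) : ℝ) : ℂ))
    (h0 : Ψ ![e 0, e 1, e 2, e 3] + Ψ ![e 0, e 1, e 4, e 5] + Ψ ![e 2, e 3, e 4, e 5] = 0) :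
    Ψ = 0 := by
  have heW : ∀ i : Fin 6, 2 ≤ i → e i ∈ W := by
    intro i hi
    rw [hmem, he.orthonormal, he.orthonormal, if_neg, if_neg]
    · simp
    · rintro rfl; revert hi; decide
    · rintro rfl; revert hi; decide
  set x := e 0 with hx
  have hx1 : e 1 = j x := he.e1
  have hsum : ∑ i : Fin 6, (b (e i) (j ⁅x, j ⁅x, e i⁆⁆) + b (e i) (j ⁅j x, j ⁅j x, e i⁆⁆)) = 0 := by
    have hT : ∀ y : L, ∑ i : Fin 6, b (e i) (j ⁅y, j ⁅y, e i⁆⁆) = 0 := by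
      intro y
      have := h.trace_comp_ad_sq hjW y (fun z => hW _ z) (fun z hz => hab _ (hW _ _) z hz)
      rw [he.trace_eq] at this
      simpa using this
    rw [Finset.sum_add_distrib, hT, hT, add_zero]
  have h01 : ∀ y z : L, b (e 0) (j ⁅y, z⁆) = 0 ∧ b (e 1) (j ⁅y, z⁆) = 0 := fun y z =>
    (hmem _).1 (hjW _ (hW y z))
  have hdd : ∀ v ∈ W, Ψ ![x, j x, v, j v] = Complex.I / 2 *
      ((b v (j ⁅x, j ⁅x, v⁆⁆) + b (j v) (j ⁅x, j ⁅x, j v⁆⁆)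
        + b v (j ⁅j x, j ⁅j x, v⁆⁆) + b (j v) (j ⁅j x, j ⁅j x, j v⁆⁆)
        - b ⁅x, v⁆ ⁅x, v⁆ - b ⁅x, j v⁆ ⁅x, j v⁆
        - b ⁅j x, v⁆ ⁅j x, v⁆ - b ⁅j x, j v⁆ ⁅j x, j v⁆ : ℝ) : ℂ) := by
    intro v hv
    have h1 := h.dJdFundamental_abelian hjW hW hab x hv
    have h2 := h.dJdFundamental_abelian hjW hW hab (j x) (hjW v hv)
    simp only [h.sq, map_neg, neg_lie, lie_neg, neg_neg, LinearMap.neg_apply] at h2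
    rw [hΨ]
    simp only [Matrix.cons_val]
    simp only [h.sq]
    rw [h1, h2]
    push_cast
    ring
  have hW4 : Ψ ![e 2, e 3, e 4, e 5] = 0 := by
    have h2 := heW 2 le_rfl
    have h4 := heW 4 (by decide)
    have e0 : ∀ x y, dFundamental j b (j (0 : L)) x y = 0 := by intro x y; simp [dFundamental]
    have hz : ∀ p ∈ W, ∀ q ∈ W, ∀ r ∈ W, ∀ s ∈ W, dJdFundamental j b p q r s = 0 := by
      intro p hp q hq r hr s hs
      simp only [dJdFundamental, hab p hp q hq, hab p hp r hr, hab p hp s hs, hab q hq r hr,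
        hab q hq s hs, hab r hr s hs, e0]
      ring
    rw [hΨ, he.e3, he.e5]
    simp only [Matrix.cons_val]
    have := hjW _ h2
    have := hjW _ h4
    rw [hz _ ‹_› _ ‹_› _ ‹_› _ ‹_›, hz _ ‹_› _ (hjW _ ‹_›) _ ‹_› _ (hjW _ ‹_›)]
    simp
  have hsq : ∑ i ∈ ({2, 3, 4, 5} : Finset (Fin 6)),
      (b ⁅x, e i⁆ ⁅x, e i⁆ + b ⁅j x, e i⁆ ⁅j x, e i⁆) = 0 := by
    rw [hW4, hx1, he.e3, he.e5, hdd _ (heW 2 le_rfl), hdd _ (heW 4 (by decide)), add_zero,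
      ← mul_add, mul_eq_zero] at h0
    have h1 := h0.resolve_left (by simp)
    norm_cast at h1
    simp only [Fin.sum_univ_six, (h01 _ _).1, he.e3, he.e5, hx1] at hsum
    rw [← hx1] at hsum
    simp only [(h01 _ _).2] at hsum
    rw [hx1] at hsum
    rw [Finset.sum_insert (by decide), Finset.sum_insert (by decide),
      Finset.sum_insert (by decide), Finset.sum_singleton, he.e3, he.e5]
    linarith
  have hnn : ∀ y, 0 ≤ b y y := fun y => by
    rcases eq_or_ne y 0 with rfl | hy
    · simp
    · exact (h.pos y hy).le
  have hb0 : ∀ y, b y y = 0 → y = 0 := fun y hy => by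
    by_contra h0
    exact (h.pos y h0).ne' hy
  have hzero : ∀ i : Fin 6, 2 ≤ i → ⁅x, e i⁆ = 0 ∧ ⁅j x, e i⁆ = 0 := by
    intro i hi
    have hi' : i ∈ ({2, 3, 4, 5} : Finset (Fin 6)) := by revert i; decide
    have := (Finset.sum_eq_zero_iff_of_nonneg (fun i _ => add_nonneg (hnn _) (hnn _))).1 hsq i hi'
    exact ⟨hb0 _ (by linarith [hnn ⁅x, e i⁆, hnn ⁅j x, e i⁆]),
      hb0 _ (by linarith [hnn ⁅x, e i⁆, hnn ⁅j x, e i⁆])⟩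
  have hcen : ∀ w ∈ W, ∀ y : L, ⁅w, y⁆ = 0 := by
    intro w hw
    have hx0 : ∀ k : Fin 6, ⁅e k, w⁆ = 0 := by
      intro k
      by_cases hk : 2 ≤ k
      · exact hab _ (heW k hk) _ hw
      · rw [← e.sum_repr w, lie_sum]
        refine Finset.sum_eq_zero fun i _ => ?_
        rw [lie_smul, he.repr_eq]
        by_cases hi : 2 ≤ i
        · have : k = 0 ∨ k = 1 := by revert k; decide
          rcases this with rfl | rfl
          · rw [(hzero i hi).1, smul_zero]
          · rw [hx1, (hzero i hi).2, smul_zero]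
        · have : i = 0 ∨ i = 1 := by revert i; decide
          rcases this with rfl | rfl
          · rw [((hmem w).1 hw).1, zero_smul]
          · rw [((hmem w).1 hw).2, zero_smul]
    intro y
    rw [← e.sum_repr y, lie_sum]
    refine Finset.sum_eq_zero fun k _ => ?_
    rw [lie_smul, ← lie_skew, hx0, neg_zero, smul_zero]
  have hlast : ∀ p q, ∀ r ∈ W, ∀ s ∈ W, dJdFundamental j b p q r s = 0 := by
    intro p q r hr s hs
    have hc : ∀ w ∈ W, ∀ y : L, ⁅y, w⁆ = 0 := fun w hw y => by
      rw [← lie_skew, hcen w hw, neg_zero]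
    simp only [dJdFundamental, dFundamental, hc r hr, hc s hs,
      hc _ (hjW r hr), hc _ (hjW s hs), map_zero,
      LinearMap.zero_apply, zero_lie]
    ring
  refine eq_zero_of_strictMono Ψ e fun t ht => ?_
  -- `W` is spanned by the last four basis vectors, so the last two entries of an increasing
  -- quadruple are central.
  have ht2 : 2 ≤ t 2 := by
    have h1 := ht (show (0 : Fin 4) < 1 by decide)
    have h2 := ht (show (1 : Fin 4) < 2 by decide)
    omega
  have ht3 : 2 ≤ t 3 := ht2.trans (ht (show (2 : Fin 4) < 3 by decide)).le
  rw [hΨ, hlast _ _ _ (heW _ ht2) _ (heW _ ht3), hlast _ _ _ (hjW _ (heW _ ht2)) _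
    (hjW _ (heW _ ht3))]
  simp

end Torsion

/-! ### The case distinction on the Lie algebra -/

section FirstGauduchon

variable {L : Type*} [LieRing L] [LieAlgebra ℝ L]
  {j : L →ₗ[ℝ] L} {b : L →ₗ[ℝ] L →ₗ[ℝ] ℝ}

/-- If the derived algebra lies in a central `j`-invariant subspace which contains the last two
vectors of a unitary basis, then only one component of `dJdΩ` survives. -/
theorem IsUnitaryBasis.eq_zero_of_central {e : Module.Basis (Fin 6) ℝ L}
    (he : IsUnitaryBasis j b e) {Z : Submodule ℝ L} (hjZ : ∀ x ∈ Z, j x ∈ Z)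
    (hZ : ∀ x y : L, ⁅x, y⁆ ∈ Z) (hcen : ∀ x : L, ∀ y ∈ Z, ⁅x, y⁆ = 0)
    (h4 : e 4 ∈ Z) (Ψ : L [⋀^Fin 4]→ₗ[ℝ] ℂ)
    (hΨ : ∀ v, Ψ v = Complex.I / 4 * ((dJdFundamental j b (v 0) (v 1) (v 2) (v 3)
      + dJdFundamental j b (j (v 0)) (j (v 1)) (j (v 2)) (j (v 3)) : ℝ) : ℂ))
    (h0 : Ψ ![e 0, e 1, e 2, e 3] + Ψ ![e 0, e 1, e 4, e 5] + Ψ ![e 2, e 3, e 4, e 5] = 0) :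
    Ψ = 0 := by
  have h5 : e 5 ∈ Z := he.e5 ▸ hjZ _ h4
  have hcen' : ∀ y ∈ Z, ∀ x : L, ⁅y, x⁆ = 0 := fun y hy x => by
    rw [← lie_skew, hcen x y hy, neg_zero]
  -- Brackets with `s` vanish; in the other summands both `j[·,·]` and `js` are central, so every
  -- bracket inside `dΩ` vanishes.
  have hlast : ∀ p q r, ∀ s ∈ Z, dJdFundamental j b p q r s = 0 := by
    intro p q r s hs
    have hb : ∀ x y : L, j ⁅x, y⁆ ∈ Z := fun x y => hjZ _ (hZ x y)
    have hbr : ∀ x y z : L, ⁅j ⁅x, y⁆, z⁆ = 0 := fun x y z => hcen' _ (hb x y) z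
    simp only [dJdFundamental, dFundamental, hcen _ s hs, hcen _ _ (hjZ s hs), hbr, map_zero,
      LinearMap.zero_apply, zero_lie]
    ring
  have hΨ0 : ∀ p q r, ∀ s ∈ Z, Ψ ![p, q, r, s] = 0 := by
    intro p q r s hs
    rw [hΨ]
    simp only [Matrix.cons_val]
    rw [hlast _ _ _ _ hs, hlast _ _ _ _ (hjZ s hs)]
    simp
  rw [hΨ0 _ _ _ _ h5, hΨ0 _ _ _ _ h5, add_zero, add_zero] at h0
  refine eq_zero_of_strictMono Ψ e fun t ht => ?_
  have hvec : (fun i => e (t i)) = ![e (t 0), e (t 1), e (t 2), e (t 3)] := by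
    ext i; fin_cases i <;> rfl
  rw [hvec]
  have h01 := ht (show (0 : Fin 4) < 1 by decide)
  have h12 := ht (show (1 : Fin 4) < 2 by decide)
  have h23 := ht (show (2 : Fin 4) < 3 by decide)
  have hcases : t 3 = 4 ∨ t 3 = 5 ∨ (t 0 = 0 ∧ t 1 = 1 ∧ t 2 = 2 ∧ t 3 = 3) := by omega
  rcases hcases with h3 | h3 | ⟨k0, k1, k2, k3⟩
  · rw [h3]; exact hΨ0 _ _ _ _ h4
  · rw [h3]; exact hΨ0 _ _ _ _ h5
  · rw [k0, k1, k2, k3]; exact h0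

theorem IsHermitian.exists_unit_orthogonal [FiniteDimensional ℝ L] (h : IsHermitian j b) {n : ℕ}
    (v : Fin n → L) (hn : n < Module.finrank ℝ L) : ∃ x, b x x = 1 ∧ ∀ i, b x (v i) = 0 := by
  have hne : ¬ (⊤ : Submodule ℝ L) ≤ Submodule.span ℝ (Set.range v) := by
    intro hle
    have h1 := finrank_range_le_card (R := ℝ) v
    rw [Set.finrank, top_le_iff.1 hle, finrank_top, Fintype.card_fin] at h1
    omega
  obtain ⟨x, -, h1, h2⟩ := h.exists_unit_normal le_top hne
  exact ⟨x, h1, fun i => h2 _ (Submodule.subset_span ⟨i, rfl⟩)⟩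

/-- The orthogonal complement of the complex line spanned by `x`. -/
def complexOrthogonal (j : L →ₗ[ℝ] L) (b : L →ₗ[ℝ] L →ₗ[ℝ] ℝ) (x : L) : Submodule ℝ L :=
  LinearMap.ker (b x) ⊓ LinearMap.ker (b (j x))

theorem mem_complexOrthogonal {x y : L} :
    y ∈ complexOrthogonal j b x ↔ b x y = 0 ∧ b (j x) y = 0 := Iff.rfl

theorem IsHermitian.map_mem_complexOrthogonal (h : IsHermitian j b) (x : L) :
    ∀ y ∈ complexOrthogonal j b x, j y ∈ complexOrthogonal j b x := by
  intro y hy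
  rw [mem_complexOrthogonal] at hy ⊢
  exact ⟨by rw [← neg_neg (b x (j y)), ← h.map_left, hy.2, neg_zero], by rw [h.map_map, hy.1]⟩

theorem IsHermitian.sub_sub_mem_complexOrthogonal (h : IsHermitian j b) {x : L} (hx : b x x = 1)
    (y : L) : y - b x y • x - b (j x) y • j x ∈ complexOrthogonal j b x := by
  rw [mem_complexOrthogonal]
  have h1 := h.map_self x
  have h2 := h.map_left x x
  have h3 := h.map_map x x
  simp only [map_sub, map_smul, smul_eq_mul]
  constructor
  · rw [h1, hx]; ring
  · rw [h2, h3, h1, hx]; ring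

/-- The algebraic core: in a nilpotent Lie algebra of dimension six with an integrable complex
structure and a Hermitian inner product, the form `Ψ = ∂∂̄Ω` vanishes as soon as its trace does. -/
theorem IsHermitian.eq_zero_of_trace_eq_zero [LieRing.IsNilpotent L] (h : IsHermitian j b)
    (hL : Module.finrank ℝ L = 6) (Ψ : L [⋀^Fin 4]→ₗ[ℝ] ℂ)
    (hΨ : ∀ v, Ψ v = Complex.I / 4 * ((dJdFundamental j b (v 0) (v 1) (v 2) (v 3)
      + dJdFundamental j b (j (v 0)) (j (v 1)) (j (v 2)) (j (v 3)) : ℝ) : ℂ))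
    (h0 : ∀ e : Module.Basis (Fin 6) ℝ L, IsUnitaryBasis j b e →
      Ψ ![e 0, e 1, e 2, e 3] + Ψ ![e 0, e 1, e 4, e 5] + Ψ ![e 2, e 3, e 4, e 5] = 0) :
    Ψ = 0 := by
  have : FiniteDimensional ℝ L := Module.finite_of_finrank_pos (by omega)
  have : Nontrivial L := Module.nontrivial_of_finrank_pos (R := ℝ) (by omega)
  have hj := h.toIsComplexStructure
  obtain ⟨x₁, -, h11, hx₁⟩ := h.exists_unit_normal le_top
    (hj.not_le_bracketSpan_sup_map (K := ⊤) top_ne_bot (fun _ _ => trivial) fun _ _ _ _ => trivial)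
  set W := complexOrthogonal j b x₁
  have hjW := h.map_mem_complexOrthogonal x₁
  have hW : ∀ x y : L, ⁅x, y⁆ ∈ W := by
    intro x y
    have h1 := Submodule.mem_sup_left (T := (bracketSpan (⊤ : Submodule ℝ L) ⊤).map j)
      (lie_mem_bracketSpan (S := (⊤ : Submodule ℝ L)) (K := ⊤) (x := x) (y := y) trivial trivial)
    exact mem_complexOrthogonal.2 ⟨hx₁ _ h1, by
      rw [h.map_left, hx₁ _ (hj.map_mem_sup_map h1), neg_zero]⟩
  by_cases hab : ∀ x ∈ W, ∀ y ∈ W, ⁅x, y⁆ = 0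
  -- In the abelian case any unitary basis starting with `x₁` will do.
  · obtain ⟨x₂, h22, hx₂⟩ := h.exists_unit_orthogonal ![x₁, j x₁] (by omega)
    obtain ⟨x₃, h33, hx₃⟩ := h.exists_unit_orthogonal ![x₁, j x₁, x₂, j x₂] (by omega)
    simp only [Fin.forall_fin_two, Matrix.cons_val] at hx₂
    simp only [Fin.forall_fin_succ, Matrix.cons_val_zero, Matrix.cons_val_succ,
      IsEmpty.forall_iff, and_true] at hx₃
    obtain ⟨a1, a2, a3, a4⟩ := hx₃
    obtain ⟨e, he, e0, e2, e4⟩ := h.exists_unitaryBasis hL h11 h22 h33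
      (by rw [h.symm, hx₂.1]) (by rw [h.symm, h.map_left, hx₂.2, neg_zero])
      (by rw [h.symm, a1]) (by rw [h.symm, h.map_left, a2, neg_zero])
      (by rw [h.symm, a3]) (by rw [h.symm, h.map_left, a4, neg_zero])
    refine h.eq_zero_of_abelian he hjW hW hab (fun x => ?_) Ψ hΨ (h0 e he)
    rw [he.e1, e0, mem_complexOrthogonal]
  · have hWbot : W ≠ ⊥ := by
      intro hbot
      refine hab fun x hx y hy => ?_
      rw [hbot, Submodule.mem_bot] at hx
      rw [hx, zero_lie]
    have hD : bracketSpan W W ⊔ (bracketSpan W W).map j ≤ W := by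
      have : bracketSpan W W ≤ W := by
        refine Submodule.span_le.2 ?_
        rintro _ ⟨x, -, y, -, rfl⟩
        exact hW x y
      exact sup_le this (Submodule.map_le_iff_le_comap.2 fun x hx => hjW x (this hx))
    obtain ⟨x₂, hx₂W, h22, hx₂⟩ := h.exists_unit_normal hD
      (hj.not_le_bracketSpan_sup_map hWbot hjW fun x _ y _ => hW x y)
    set Z := W ⊓ complexOrthogonal j b x₂
    have hjZ : ∀ x ∈ Z, j x ∈ Z := fun x hx =>
      ⟨hjW x hx.1, h.map_mem_complexOrthogonal x₂ x hx.2⟩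
    have hWZ : ∀ x ∈ W, ∀ y ∈ W, ⁅x, y⁆ ∈ Z := by
      intro x hx y hy
      have h1 := Submodule.mem_sup_left (T := (bracketSpan W W).map j) (lie_mem_bracketSpan hx hy)
      exact ⟨hW x y, mem_complexOrthogonal.2 ⟨hx₂ _ h1, by
        rw [h.map_left, hx₂ _ (hj.map_mem_sup_map h1), neg_zero]⟩⟩
    obtain ⟨x₃, h33, hx₃⟩ := h.exists_unit_orthogonal ![x₁, j x₁, x₂, j x₂] (by omega)
    simp only [Fin.forall_fin_succ, Matrix.cons_val_zero, Matrix.cons_val_succ,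
      IsEmpty.forall_iff, and_true] at hx₃
    obtain ⟨a1, a2, a3, a4⟩ := hx₃
    have hx₂' := mem_complexOrthogonal.1 hx₂W
    obtain ⟨e, he, e0, e2, e4⟩ := h.exists_unitaryBasis hL h11 h22 h33
      hx₂'.1 (mem_complexOrthogonal.1 (hjW _ hx₂W)).1
      (by rw [h.symm, a1]) (by rw [h.symm, h.map_left, a2, neg_zero])
      (by rw [h.symm, a3]) (by rw [h.symm, h.map_left, a4, neg_zero])
    have hx₃Z : x₃ ∈ Z := ⟨mem_complexOrthogonal.2 ⟨by rw [h.symm, a1], by rw [h.symm, a2]⟩,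
      mem_complexOrthogonal.2 ⟨by rw [h.symm, a3], by rw [h.symm, a4]⟩⟩
    have hZspan : ∀ y ∈ Z, ∃ c d : ℝ, y - c • x₃ - d • j x₃ ∈ (⊥ : Submodule ℝ L) := by
      intro y hy
      have hy1 := mem_complexOrthogonal.1 hy.1
      have hy2 := mem_complexOrthogonal.1 hy.2
      refine ⟨b x₃ y, b (j x₃) y, ?_⟩
      have := e.sum_repr y
      simp only [he.repr_eq, Fin.sum_univ_six, he.e1, he.e3, he.e5, e0, e2, e4, hy1.1, hy1.2,
        hy2.1, hy2.2, zero_smul, zero_add] at this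
      rw [Submodule.mem_bot]
      nth_rewrite 1 [← this]
      abel
    have hWspan : ∀ y ∈ W, ∃ c d : ℝ, y - c • x₂ - d • j x₂ ∈ Z := fun y hy =>
      ⟨b x₂ y, b (j x₂) y, sub_mem (sub_mem hy (W.smul_mem _ hx₂W)) (W.smul_mem _ (hjW _ hx₂W)),
        h.sub_sub_mem_complexOrthogonal h22 y⟩
    have hbot : ∀ x ∈ (⊥ : Submodule ℝ L), j x ∈ (⊥ : Submodule ℝ L) := by
      rintro x rfl; simp
    have hbot' : ∀ x : L, ∀ y ∈ (⊥ : Submodule ℝ L), ⁅x, y⁆ ∈ (⊥ : Submodule ℝ L) := by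
      rintro x y rfl; simp
    -- `W` acts on the complex line `Z`, hence trivially.
    have hWZ0 : ∀ x ∈ W, ∀ y ∈ Z, ⁅x, y⁆ = 0 :=
      hj.lie_mem_of_line hjW hjZ hbot x₃ hZspan (fun x hx y hy => hWZ x hx y hy.1)
        fun x _ => hbot' x
    -- The centre of `W` lies in `Z`: `W` is spanned by `x₂`, `j x₂` and `Z`, and `[x₂, j x₂] ≠ 0`
    -- since otherwise `W` would be abelian.
    have hcenter : ∀ w ∈ W, (∀ y ∈ W, ⁅w, y⁆ = 0) → w ∈ Z := by
      intro w hw hwW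
      obtain ⟨c, d, hcd⟩ := hWspan w hw
      have hne : ⁅x₂, j x₂⁆ ≠ 0 := by
        intro h2
        refine hab fun x hx y hy => ?_
        obtain ⟨p, q, hpq⟩ := hWspan x hx
        obtain ⟨r, s, hrs⟩ := hWspan y hy
        have ey : y = (y - r • x₂ - s • j x₂) + r • x₂ + s • j x₂ := by abel
        have k1 : ⁅x₂, y⁆ = 0 := by
          rw [ey, lie_add, lie_add, hWZ0 _ hx₂W _ hrs, lie_smul, lie_smul, lie_self, h2]; simp
        have k2 : ⁅j x₂, y⁆ = 0 := by
          rw [ey, lie_add, lie_add, hWZ0 _ (hjW _ hx₂W) _ hrs, lie_smul, lie_smul, lie_self,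
            ← lie_skew, h2]
          simp
        have ex : x = (x - p • x₂ - q • j x₂) + p • x₂ + q • j x₂ := by abel
        rw [ex, add_lie, add_lie, smul_lie, smul_lie, k1, k2, ← lie_skew, hWZ0 _ hy _ hpq]
        simp
      have ew : w = (w - c • x₂ - d • j x₂) + c • x₂ + d • j x₂ := by abel
      have hd : d = 0 := by
        have := hwW x₂ hx₂W
        rw [ew, add_lie, add_lie, smul_lie, smul_lie, lie_self, ← lie_skew, hWZ0 _ hx₂W _ hcd,
          smul_zero, add_zero, neg_zero, zero_add] at this
        exact (smul_eq_zero.1 this).resolve_right fun h' => hne (by rw [← lie_skew, h', neg_zero])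
      have hc : c = 0 := by
        have := hwW (j x₂) (hjW _ hx₂W)
        rw [ew, add_lie, add_lie, smul_lie, smul_lie, lie_self, ← lie_skew,
          hWZ0 _ (hjW _ hx₂W) _ hcd] at this
        simpa [hne] using this
      simpa [hc, hd] using hcd
    -- By the Jacobi identity `[x, y]` is central in the ideal `W`, so it lies in `Z`. With `Z` an
    -- ideal, the line lemma applies to the action of all of `L` on `Z` and on `W / Z`.
    have hLZ : ∀ x : L, ∀ y ∈ Z, ⁅x, y⁆ ∈ Z := by
      intro x y hy
      refine hcenter _ (hW x y) fun w hw => ?_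
      rw [lie_lie, ← lie_skew y w, hWZ0 w hw y hy, ← lie_skew y, hWZ0 _ (hW x w) y hy]
      simp
    have hcen : ∀ x : L, ∀ y ∈ Z, ⁅x, y⁆ = 0 := fun x y hy =>
      hj.lie_mem_of_line (K := ⊤) (fun _ _ => trivial) hjZ hbot x₃ hZspan (fun x _ => hLZ x)
        (fun x _ => hbot' x) x trivial y hy
    have hLW : ∀ x : L, ∀ y ∈ W, ⁅x, y⁆ ∈ Z := fun x y hy =>
      hj.lie_mem_of_line (K := ⊤) (fun _ _ => trivial) hjW hjZ x₂ hWspan (fun x _ y _ => hW x y)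
        (fun x _ => hLZ x) x trivial y hy
    -- Jacobi again: `[L, W] ≤ Z` is central, so `[x₁, j x₁]` commutes with `W`. This is the only
    -- bracket not covered by `hLW`, because `L` is spanned by `x₁`, `j x₁` and `W`.
    have hx₁x₁ : ⁅x₁, j x₁⁆ ∈ Z := by
      refine hcenter _ (hW _ _) fun w hw => ?_
      rw [lie_lie, hcen _ _ (hLW _ w hw), hcen _ _ (hLW _ w hw), sub_zero]
    have hLL : ∀ x y : L, ⁅x, y⁆ ∈ Z := by
      intro x y
      have hx := h.sub_sub_mem_complexOrthogonal h11 x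
      have hy := h.sub_sub_mem_complexOrthogonal h11 y
      set x' := x - b x₁ x • x₁ - b (j x₁) x • j x₁ with hx'
      set y' := y - b x₁ y • x₁ - b (j x₁) y • j x₁ with hy'
      have ex : x = x' + b x₁ x • x₁ + b (j x₁) x • j x₁ := by rw [hx']; abel
      have ey : y = y' + b x₁ y • x₁ + b (j x₁) y • j x₁ := by rw [hy']; abel
      have : ⁅x, y⁆ = ⁅x, y'⁆ - ⁅b x₁ y • x₁ + b (j x₁) y • j x₁, x'⁆
          + (b x₁ x * b (j x₁) y - b (j x₁) x * b x₁ y) • ⁅x₁, j x₁⁆ := by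
        nth_rewrite 1 [ey]
        rw [add_assoc, lie_add]
        nth_rewrite 2 [ex]
        rw [add_assoc, add_lie, ← lie_skew x']
        simp only [add_lie, lie_add, lie_smul, smul_lie, lie_self, ← lie_skew (j x₁) x₁]
        module
      rw [this]
      exact add_mem (sub_mem (hLW _ _ hy) (hLW _ _ hx)) (Z.smul_mem _ hx₁x₁)
    exact he.eq_zero_of_central hjZ hLL hcen (e4 ▸ hx₃Z) Ψ hΨ (h0 e he)

end FirstGauduchon

/-! ### The wedge product with a symplectic form -/

section Wedge

open Equiv

variable {V : Type*} [AddCommGroup V] [Module ℝ V]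

/-- Three permutations of `Fin 4 ⊕ Fin 2`, which move one of the pairs `{0, 1}`, `{2, 3}`, `{4, 5}`
to the last two places. -/
def pairShuffle : Fin 3 → Perm (Fin 4 ⊕ Fin 2) :=
  ![swap (.inl 0) (.inr 0) * swap (.inl 1) (.inr 1), swap (.inl 2) (.inr 0) * swap (.inl 3) (.inr 1),
    1]

/-- Halving an index names its symplectic pair. Shuffles feeding `Ω` two vectors of different pairs
contribute zero; the others lie in the coset of some `pairShuffle m`. -/
theorem exists_pairShuffle (x y : Fin 4 ⊕ Fin 2) (hxy : x ≠ y)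
    (h : (finSumFinEquiv x : ℕ) / 2 = (finSumFinEquiv y : ℕ) / 2) :
    ∃ m, ((pairShuffle m).symm x).isRight ∧ ((pairShuffle m).symm y).isRight := by
  revert x y
  decide

/-- The three cosets are distinct, so each pair is counted once. -/
theorem eq_of_pairShuffle (m n : Fin 3)
    (h : ((pairShuffle m).symm (pairShuffle n (.inr 0))).isRight) : m = n := by
  revert m n
  decide

theorem wedge_apply {k l : ℕ} (ψ : V [⋀^Fin k]→ₗ[ℝ] ℂ) (Ω : V [⋀^Fin l]→ₗ[ℝ] ℂ)
    (v : Fin (k + l) → V) : wedge ψ Ω v = ∑ σ : Perm.ModSumCongr (Fin k) (Fin l),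
      LinearMap.mul' ℝ ℂ (AlternatingMap.domCoprod.summand ψ Ω σ fun i => v (finSumFinEquiv i)) := by
  rw [← map_sum, ← sum_apply]
  rfl

theorem mul'_summand_apply {k l : ℕ} (ψ : V [⋀^Fin k]→ₗ[ℝ] ℂ) (Ω : V [⋀^Fin l]→ₗ[ℝ] ℂ)
    (σ : Perm (Fin k ⊕ Fin l)) (v : Fin k ⊕ Fin l → V) :
    LinearMap.mul' ℝ ℂ (AlternatingMap.domCoprod.summand ψ Ω (Quotient.mk'' σ) v)
      = Perm.sign σ • (ψ (fun i => v (σ (.inl i))) * Ω fun i => v (σ (.inr i))) := by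
  rw [AlternatingMap.domCoprod.summand_mk'']
  rcases Int.units_eq_one_or (Perm.sign σ) with h | h <;> simp [h]

/-- The wedge product of a 4-form with a 2-form for which the given vectors are a symplectic
basis. -/
theorem wedge_apply_of_symplectic (ψ : V [⋀^Fin 4]→ₗ[ℝ] ℂ) (Ω : V [⋀^Fin 2]→ₗ[ℝ] ℂ)
    (e : Fin 6 → V) (h0 : ∀ i k : Fin 6, (i : ℕ) / 2 ≠ (k : ℕ) / 2 → Ω ![e i, e k] = 0)
    (h01 : Ω ![e 0, e 1] = 1) (h23 : Ω ![e 2, e 3] = 1) (h45 : Ω ![e 4, e 5] = 1) :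
    wedge ψ Ω e = ψ ![e 0, e 1, e 2, e 3] + ψ ![e 0, e 1, e 4, e 5] + ψ ![e 2, e 3, e 4, e 5] := by
  have h1 : ∀ (σ : Perm (Fin 4 ⊕ Fin 2)), (Ω fun i => e (finSumFinEquiv (σ (.inr i))))
      = Ω ![e (finSumFinEquiv (σ (.inr 0))), e (finSumFinEquiv (σ (.inr 1)))] := by
    intro σ
    congr 1
    ext i
    fin_cases i <;> rfl
  have hout : ∀ σ : Perm (Fin 4 ⊕ Fin 2),
      (Quotient.mk'' σ : Perm.ModSumCongr (Fin 4) (Fin 2)) ∉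
        (fun m => Quotient.mk'' (pairShuffle m)) '' (↑(Finset.univ : Finset (Fin 3)) : Set (Fin 3)) →
      (Ω fun i => e (finSumFinEquiv (σ (.inr i)))) = 0 := by
    intro σ hσ
    rw [h1]
    refine h0 _ _ fun hp => hσ ?_
    obtain ⟨m, hm0, hm1⟩ := exists_pairShuffle (σ (.inr 0)) (σ (.inr 1)) (by simp) hp
    refine ⟨m, by simp, Quotient.sound' ?_⟩
    rw [QuotientGroup.leftRel_apply]
    refine Perm.mem_sumCongrHom_range_of_perm_mapsTo_inl
      ((Perm.perm_mapsTo_inl_iff_mapsTo_inr _).2 ?_)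
    rintro _ ⟨i, rfl⟩
    have hi : (((pairShuffle m)⁻¹ * σ) (.inr i)).isRight := by
      fin_cases i
      · exact hm0
      · exact hm1
    obtain ⟨y, hy⟩ := Sum.isRight_iff.1 hi
    exact ⟨y, hy.symm⟩
  have key := Finset.sum_of_injOn (s := (Finset.univ : Finset (Fin 3))) (t := Finset.univ)
    (f := fun m => LinearMap.mul' ℝ ℂ (AlternatingMap.domCoprod.summand ψ Ω
      (Quotient.mk'' (pairShuffle m)) fun i => e (finSumFinEquiv i)))
    (g := fun σ : Perm.ModSumCongr (Fin 4) (Fin 2) => LinearMap.mul' ℝ ℂ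
      (AlternatingMap.domCoprod.summand ψ Ω σ fun i => e (finSumFinEquiv i)))
    (fun m => Quotient.mk'' (pairShuffle m)) ?_ ?_ ?_ fun _ _ => rfl
  · rw [wedge_apply]
    refine key.symm.trans ?_
    have s0 : Perm.sign (pairShuffle 0) = 1 := by decide
    have s1 : Perm.sign (pairShuffle 1) = 1 := by decide
    have s2 : Perm.sign (pairShuffle 2) = 1 := by decide
    have o0 : (Ω fun i => e (finSumFinEquiv (pairShuffle 0 (.inr i)))) = 1 := (h1 _).trans h01
    have o1 : (Ω fun i => e (finSumFinEquiv (pairShuffle 1 (.inr i)))) = 1 := (h1 _).trans h23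
    have o2 : (Ω fun i => e (finSumFinEquiv (pairShuffle 2 (.inr i)))) = 1 := (h1 _).trans h45
    -- Here `ψ` receives the vectors in the order `4, 5, 2, 3`, an even rearrangement.
    have p0 : (ψ fun i => e (finSumFinEquiv (pairShuffle 0 (.inl i)))) = ψ ![e 2, e 3, e 4, e 5] := by
      rw [show (fun i => e (finSumFinEquiv (pairShuffle 0 (.inl i)))) =
        ![e 2, e 3, e 4, e 5] ∘ (swap 0 2 * swap 1 3 : Perm (Fin 4)) by
          ext i; fin_cases i <;> rfl, ψ.map_perm,
        show Perm.sign (swap 0 2 * swap 1 3 : Perm (Fin 4)) = 1 by decide, one_smul]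
    have p1 : (ψ fun i => e (finSumFinEquiv (pairShuffle 1 (.inl i)))) = ψ ![e 0, e 1, e 4, e 5] := by
      congr 1; ext i; fin_cases i <;> rfl
    have p2 : (ψ fun i => e (finSumFinEquiv (pairShuffle 2 (.inl i)))) = ψ ![e 0, e 1, e 2, e 3] := by
      congr 1; ext i; fin_cases i <;> rfl
    simp only [mul'_summand_apply, Fin.sum_univ_three, s0, s1, s2, o0, o1, o2, p0, p1, p2, one_smul,
      mul_one]
    ring
  · intro m _ n _ hmn
    have h2 := QuotientGroup.leftRel_apply.1 (Quotient.exact' hmn)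
    obtain ⟨⟨sl, sr⟩, h⟩ := h2
    refine eq_of_pairShuffle m n ?_
    have h3 := congrArg (fun τ : Perm (Fin 4 ⊕ Fin 2) => (τ (.inr 0)).isRight) h
    exact h3.symm
  · simp
  · intro σ _ hσ
    induction σ using Quotient.inductionOn' with | _ σ
    rw [mul'_summand_apply, hout σ hσ, mul_zero, smul_zero]

theorem zero_wedge {k l : ℕ} (Ω : V [⋀^Fin l]→ₗ[ℝ] ℂ) :
    wedge (0 : V [⋀^Fin k]→ₗ[ℝ] ℂ) Ω = 0 := by
  ext v
  rw [wedge_apply, AlternatingMap.zero_apply]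
  refine Finset.sum_eq_zero fun σ _ => ?_
  induction σ using Quotient.inductionOn' with | _ σ
  rw [mul'_summand_apply, AlternatingMap.zero_apply, zero_mul, smul_zero]

end Wedge

/-! ### Chevalley–Eilenberg computation of `∂∂̄Ω` -/

section Cochains

variable {L : Type*}

theorem ceD_two_apply (br : L → L → L) (φ : (Fin 2 → L) → ℂ) (v : Fin 3 → L) :
    ceD br φ v = -φ ![br (v 0) (v 1), v 2] + φ ![br (v 0) (v 2), v 1]
      - φ ![br (v 1) (v 2), v 0] := by
  have e0 : (0 : Fin 2).removeNth ((0 : Fin 3).removeNth v) = ![v 2] := by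
    ext i; fin_cases i; rfl
  have e1 : (1 : Fin 2).removeNth ((0 : Fin 3).removeNth v) = ![v 1] := by
    ext i; fin_cases i; rfl
  have e2 : (1 : Fin 2).removeNth ((1 : Fin 3).removeNth v) = ![v 0] := by
    ext i; fin_cases i; rfl
  have s0 : Finset.Ici (0 : Fin 2) = {0, 1} := by decide
  have s1 : Finset.Ici (1 : Fin 2) = {1} := by decide
  have c0 : (0 : Fin 2).castSucc = 0 := rfl
  have c1 : (1 : Fin 2).castSucc = 1 := rfl
  have d0 : (0 : Fin 2).succ = 1 := rfl
  have d1 : (1 : Fin 2).succ = 2 := rfl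
  simp [ceD, -Fin.removeNth_zero, Fin.sum_univ_two, s0, s1, c0, c1, d0, d1, e0, e1, e2]
  ring

theorem ceD_three_apply (br : L → L → L) (φ : (Fin 3 → L) → ℂ) (v : Fin 4 → L) :
    ceD br φ v = -φ ![br (v 0) (v 1), v 2, v 3] + φ ![br (v 0) (v 2), v 1, v 3]
      - φ ![br (v 0) (v 3), v 1, v 2] - φ ![br (v 1) (v 2), v 0, v 3]
      + φ ![br (v 1) (v 3), v 0, v 2] - φ ![br (v 2) (v 3), v 0, v 1] := by
  have e0 : (0 : Fin 3).removeNth ((0 : Fin 4).removeNth v) = ![v 2, v 3] := by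
    ext i; fin_cases i <;> rfl
  have e1 : (1 : Fin 3).removeNth ((0 : Fin 4).removeNth v) = ![v 1, v 3] := by
    ext i; fin_cases i <;> rfl
  have e2 : (2 : Fin 3).removeNth ((0 : Fin 4).removeNth v) = ![v 1, v 2] := by
    ext i; fin_cases i <;> rfl
  have e3 : (1 : Fin 3).removeNth ((1 : Fin 4).removeNth v) = ![v 0, v 3] := by
    ext i; fin_cases i <;> rfl
  have e4 : (2 : Fin 3).removeNth ((1 : Fin 4).removeNth v) = ![v 0, v 2] := by
    ext i; fin_cases i <;> rfl
  have e5 : (2 : Fin 3).removeNth ((2 : Fin 4).removeNth v) = ![v 0, v 1] := by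
    ext i; fin_cases i <;> rfl
  have s0 : Finset.Ici (0 : Fin 3) = {0, 1, 2} := by decide
  have s1 : Finset.Ici (1 : Fin 3) = {1, 2} := by decide
  have s2 : Finset.Ici (2 : Fin 3) = {2} := by decide
  have c0 : (0 : Fin 3).castSucc = 0 := rfl
  have c1 : (1 : Fin 3).castSucc = 1 := rfl
  have c2 : (2 : Fin 3).castSucc = 2 := rfl
  have d0 : (0 : Fin 3).succ = 1 := rfl
  have d1 : (1 : Fin 3).succ = 2 := rfl
  have d2 : (2 : Fin 3).succ = 3 := rfl
  simp [ceD, -Fin.removeNth_zero, Fin.sum_univ_three, s0, s1, s2, c0, c1, c2, d0, d1, d2, e0,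
    e1, e2, e3, e4, e5]
  ring

variable [LieRing L] [LieAlgebra ℝ L] {j : L →ₗ[ℝ] L} {b : L →ₗ[ℝ] L →ₗ[ℝ] ℝ}

/-- The fundamental form, as a complex-valued cochain. -/
def fundamental (j : L →ₗ[ℝ] L) (b : L →ₗ[ℝ] L →ₗ[ℝ] ℝ) (v : Fin 2 → L) : ℂ :=
  (b (j (v 0)) (v 1) : ℂ)

theorem ceD_fundamental (v : Fin 3 → L) : ceD (fun x y : L => ⁅x, y⁆) (fundamental j b) v
    = dFundamental j b (v 0) (v 1) (v 2) := by
  simp [ceD_two_apply, fundamental, dFundamental]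

/-- The differential of the differential of the fundamental form is zero. -/
theorem IsHermitian.d_dFundamental (h : IsHermitian j b) (w x y z : L) :
    -dFundamental j b ⁅w, x⁆ y z + dFundamental j b ⁅w, y⁆ x z - dFundamental j b ⁅w, z⁆ x y
      - dFundamental j b ⁅x, y⁆ w z + dFundamental j b ⁅x, z⁆ w y
      - dFundamental j b ⁅y, z⁆ w x = 0 := by
  -- Expanding `d²Ω`, the terms pairing two brackets cancel by this skew-symmetry and the nested
  -- brackets by the Jacobi identity.
  have hs : ∀ u v : L, b (j u) v = -b (j v) u := fun u v => by rw [h.map_left, h.symm]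
  have hjac : ∀ u v t s : L, b (j ⁅⁅u, v⁆, t⁆) s - b (j ⁅⁅u, t⁆, v⁆) s + b (j ⁅⁅v, t⁆, u⁆) s
      = 0 := by
    intro u v t s
    have h1 : ⁅⁅u, v⁆, t⁆ - ⁅⁅u, t⁆, v⁆ + ⁅⁅v, t⁆, u⁆ = 0 := by
      rw [lie_lie, ← lie_skew v ⁅u, t⁆, ← lie_skew ⁅v, t⁆ u]
      abel
    have h2 := congrArg (fun r => b (j r) s) h1
    simpa using h2
  simp only [dFundamental]
  have := hs ⁅w, x⁆ ⁅y, z⁆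
  have := hs ⁅w, y⁆ ⁅x, z⁆
  have := hs ⁅w, z⁆ ⁅x, y⁆
  linarith [hjac w x y z, hjac w x z y, hjac w y z x, hjac x y z w]

/-- The Chevalley–Eilenberg version of the operator `dᶜ`. -/
def ceDc (j : L →ₗ[ℝ] L) {n : ℕ} (φ : (Fin (n + 1) → L) → ℂ) (v : Fin (n + 2) → L) : ℂ :=
  ceD (fun x y => ⁅x, y⁆) (fun w => φ fun i => j (w i)) fun i => -j (v i)

/-- The Chevalley–Eilenberg version of the operator `∂`. -/
def ceDel (j : L →ₗ[ℝ] L) {n : ℕ} (φ : (Fin (n + 1) → L) → ℂ) (v : Fin (n + 2) → L) : ℂ :=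
  1 / 2 * (ceD (fun x y => ⁅x, y⁆) φ v + Complex.I * ceDc j φ v)

/-- The Chevalley–Eilenberg version of the operator `∂̄`. -/
def ceDelbar (j : L →ₗ[ℝ] L) {n : ℕ} (φ : (Fin (n + 1) → L) → ℂ) (v : Fin (n + 2) → L) : ℂ :=
  1 / 2 * (ceD (fun x y => ⁅x, y⁆) φ v - Complex.I * ceDc j φ v)

theorem IsHermitian.ceDelbar_fundamental (h : IsHermitian j b) (v : Fin 3 → L) :
    ceDelbar j (fundamental j b) v = 1 / 2 * ((dFundamental j b (v 0) (v 1) (v 2) : ℂ)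
      + Complex.I * (dFundamental j b (j (v 0)) (j (v 1)) (j (v 2)) : ℂ)) := by
  have h1 : (fun w : Fin 2 → L => fundamental j b fun i => j (w i)) = fundamental j b := by
    ext w
    simp only [fundamental, h.map_map]
  rw [ceDelbar, ceDc, h1, ceD_fundamental, ceD_fundamental]
  have h2 : dFundamental j b (-j (v 0)) (-j (v 1)) (-j (v 2))
      = -dFundamental j b (j (v 0)) (j (v 1)) (j (v 2)) := by
    simp only [dFundamental, neg_lie, lie_neg, neg_neg, map_neg]
    ring
  rw [h2]
  push_cast
  ring

theorem IsHermitian.ceD_ceDelbar_fundamental (h : IsHermitian j b) (v : Fin 4 → L) :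
    ceD (fun x y => ⁅x, y⁆) (ceDelbar j (fundamental j b)) v
      = Complex.I / 2 * (dJdFundamental j b (v 0) (v 1) (v 2) (v 3) : ℂ) := by
  have h1 := congrArg (fun r : ℝ => (r : ℂ)) (h.d_dFundamental (v 0) (v 1) (v 2) (v 3))
  simp only [ceD_three_apply, h.ceDelbar_fundamental, dJdFundamental, Matrix.cons_val]
  push_cast at h1 ⊢
  linear_combination 1 / 2 * h1

/-- On `∂̄Ω = (dΩ + i JdΩ)/2` the operator `J` acts as `-i`, since `J² = -1` on 3-forms. Hence
`∂∂̄Ω` is half the sum of `d∂̄Ω` and its image under `J`, and `d∂̄Ω = (i/2) dJdΩ` because `d²Ω = 0`.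
-/
theorem IsHermitian.ceDel_ceDelbar_fundamental (h : IsHermitian j b) (v : Fin 4 → L) :
    ceDel j (ceDelbar j (fundamental j b)) v = Complex.I / 4 *
      ((dJdFundamental j b (v 0) (v 1) (v 2) (v 3)
        + dJdFundamental j b (j (v 0)) (j (v 1)) (j (v 2)) (j (v 3)) : ℝ) : ℂ) := by
  have h1 : (fun w : Fin 3 → L => ceDelbar j (fundamental j b) fun i => j (w i))
      = fun w => -Complex.I * ceDelbar j (fundamental j b) w := by
    ext w
    have h2 : dFundamental j b (-w 0) (-w 1) (-w 2) = -dFundamental j b (w 0) (w 1) (w 2) := by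
      simp only [dFundamental, neg_lie, lie_neg, neg_neg, map_neg]
      ring
    rw [h.ceDelbar_fundamental, h.ceDelbar_fundamental]
    simp only [h.sq, h2]
    push_cast
    linear_combination (1 / 2 : ℂ) * dFundamental j b (j (w 0)) (j (w 1)) (j (w 2))
      * Complex.I_mul_I
  have h3 : ∀ u : Fin 4 → L, ceD (fun x y => ⁅x, y⁆)
      (fun w => -Complex.I * ceDelbar j (fundamental j b) w) u
      = -Complex.I * ceD (fun x y => ⁅x, y⁆) (ceDelbar j (fundamental j b)) u := by
    intro u
    rw [ceD_three_apply, ceD_three_apply]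
    ring
  have h4 : ∀ w x y z : L, dJdFundamental j b (-w) (-x) (-y) (-z) = dJdFundamental j b w x y z := by
    intro w x y z
    simp only [dJdFundamental, dFundamental, neg_lie, lie_neg, neg_neg, map_neg, LinearMap.neg_apply]
  rw [ceDel, ceDc, h1, h3, h.ceD_ceDelbar_fundamental, h.ceD_ceDelbar_fundamental, h4]
  push_cast
  linear_combination -(Complex.I / 4) * dJdFundamental j b (j (v 0)) (j (v 1)) (j (v 2)) (j (v 3))
    * Complex.I_mul_I

end Cochains

/-! ### Transfer of the invariant structures to the Lie algebra -/

section InvariantStructures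

variable {E : Type*} [NormedAddCommGroup E] [NormedSpace ℝ E] [FiniteDimensional ℝ E]
  {G : Type*} [Group G] [TopologicalSpace G] [ChartedSpace E G] [LieGroup 𝓘(ℝ, E) ∞ G]
  {M : Type*} [TopologicalSpace M] [ChartedSpace E M] [IsManifold 𝓘(ℝ, E) ∞ M]
  {Γ : Subgroup G} {pr : G → M} {J : ComplexStructure E M}
  {j : GroupLieAlgebra 𝓘(ℝ, E) G →ₗ[ℝ] GroupLieAlgebra 𝓘(ℝ, E) G}
  {b : GroupLieAlgebra 𝓘(ℝ, E) G →ₗ[ℝ] GroupLieAlgebra 𝓘(ℝ, E) G →ₗ[ℝ] ℝ}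

/-- The endomorphism of the Lie algebra which induces an invariant complex structure is integrable
in the algebraic sense. -/
theorem ComplexStructure.isComplexStructure (hpr : IsLeftQuotient E Γ pr)
    (hj : ∀ (a : G) (v : GroupLieAlgebra 𝓘(ℝ, E) G),
      J.J (pr a) (leftField pr v a) = leftField pr (j v) a) : IsComplexStructure j := by
  have : CompleteSpace E := FiniteDimensional.complete ℝ E
  refine ⟨fun x => leftField_injective hpr (a := 1) ?_,
    fun x y => leftField_injective hpr (a := 1) ?_⟩
  · rw [← hj, ← hj, J.J_sq, leftField_neg]
  · have hJ : ∀ v, (fun q => J.J q (inducedField hpr v q)) = inducedField hpr (j v) := by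
      intro v
      funext q
      obtain ⟨a, rfl⟩ := hpr.surjective q
      rw [inducedField_apply, inducedField_apply, hj]
    have key := J.integrable (inducedField hpr x) (inducedField hpr y)
      (contMDiff_inducedField hpr x) (contMDiff_inducedField hpr y) (pr 1)
    rw [hJ, hJ, mlieBracket_inducedField, mlieBracket_inducedField, mlieBracket_inducedField,
      mlieBracket_inducedField, inducedField_apply, inducedField_apply, inducedField_apply,
      inducedField_apply, hj, hj] at key
    rw [leftField_add, leftField_add]
    rw [sub_sub, sub_sub, sub_eq_zero] at key
    rw [key]
    abel

theorem HermitianMetric.isHermitian {g : HermitianMetric E M J} (hpr : IsLeftQuotient E Γ pr)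
    (hj : ∀ (a : G) (v : GroupLieAlgebra 𝓘(ℝ, E) G),
      J.J (pr a) (leftField pr v a) = leftField pr (j v) a)
    (hb : ∀ (a : G) (v w : GroupLieAlgebra 𝓘(ℝ, E) G),
      g.inner (pr a) (leftField pr v a) (leftField pr w a) = b v w) : IsHermitian j b where
  toIsComplexStructure := J.isComplexStructure hpr hj
  symm x y := by rw [← hb 1, ← hb 1, g.symm]
  pos x hx := by
    rw [← hb 1]
    refine g.pos _ _ fun h0 => hx ?_
    refine leftField_injective hpr (a := 1) (h0.trans ?_)
    exact ((leftFieldₗ (E := E) pr 1).map_zero).symm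
  map_map x y := by rw [← hb 1, ← hb 1, ← hj, ← hj, g.hermitian]

theorem HermitianMetric.isInduced_Omega {g : HermitianMetric E M J}
    (hj : ∀ (a : G) (v : GroupLieAlgebra 𝓘(ℝ, E) G),
      J.J (pr a) (leftField pr v a) = leftField pr (j v) a)
    (hb : ∀ (a : G) (v w : GroupLieAlgebra 𝓘(ℝ, E) G),
      g.inner (pr a) (leftField pr v a) (leftField pr w a) = b v w) :
    IsInduced pr g.Omega (fundamental j b) := by
  intro a v
  rw [HermitianMetric.Omega_apply, hj, hb]
  rfl

theorem IsInduced.dc (hpr : IsLeftQuotient E Γ pr)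
    (hj : ∀ (a : G) (v : GroupLieAlgebra 𝓘(ℝ, E) G),
      J.J (pr a) (leftField pr v a) = leftField pr (j v) a) {n : ℕ} {η : DiffForm E M (n + 1)}
    {φ : (Fin (n + 1) → GroupLieAlgebra 𝓘(ℝ, E) G) → ℂ} (hη : IsInduced pr η φ) :
    IsInduced pr (J.dc η) (ceDc j φ) := by
  have h1 : IsInduced pr (J.act η) fun w => φ fun i => j (w i) := by
    intro a v
    refine Eq.trans ?_ (hη a fun i => j (v i))
    exact congrArg (η (pr a)) (funext fun i => hj a (v i))
  intro a v
  rw [ceDc, ← h1.extD hpr a]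
  refine congrArg (Nilmanifold.extD (J.act η) (pr a)) (funext fun i => ?_)
  exact (congrArg Neg.neg (hj a (v i))).trans (leftField_neg pr (j (v i)) a).symm

theorem IsInduced.del (hpr : IsLeftQuotient E Γ pr)
    (hj : ∀ (a : G) (v : GroupLieAlgebra 𝓘(ℝ, E) G),
      J.J (pr a) (leftField pr v a) = leftField pr (j v) a) {n : ℕ} {η : DiffForm E M (n + 1)}
    {φ : (Fin (n + 1) → GroupLieAlgebra 𝓘(ℝ, E) G) → ℂ} (hη : IsInduced pr η φ) :
    IsInduced pr (J.del η) (ceDel j φ) := by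
  intro a v
  rw [ceDel, ← hη.extD hpr a, ← hη.dc hpr hj a]
  rfl

theorem IsInduced.delbar (hpr : IsLeftQuotient E Γ pr)
    (hj : ∀ (a : G) (v : GroupLieAlgebra 𝓘(ℝ, E) G),
      J.J (pr a) (leftField pr v a) = leftField pr (j v) a) {n : ℕ} {η : DiffForm E M (n + 1)}
    {φ : (Fin (n + 1) → GroupLieAlgebra 𝓘(ℝ, E) G) → ℂ} (hη : IsInduced pr η φ) :
    IsInduced pr (J.delbar η) (ceDelbar j φ) := by
  intro a v
  rw [ceDelbar, ← hη.extD hpr a, ← hη.dc hpr hj a]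
  rfl

/-- The wedge product with the fundamental form, evaluated on a unitary basis. -/
theorem IsHermitian.wedge_apply {L : Type*} [LieRing L] [LieAlgebra ℝ L] {j : L →ₗ[ℝ] L}
    {b : L →ₗ[ℝ] L →ₗ[ℝ] ℝ} (h : IsHermitian j b) {e : Module.Basis (Fin 6) ℝ L}
    (he : IsUnitaryBasis j b e) {V : Type*} [AddCommGroup V] [Module ℝ V] (T : L →ₗ[ℝ] V)
    (ψ : V [⋀^Fin 4]→ₗ[ℝ] ℂ) (Ω : V [⋀^Fin 2]→ₗ[ℝ] ℂ)
    (hΩ : ∀ x y, Ω ![T x, T y] = (b (j x) y : ℂ)) :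
    wedge ψ Ω (fun i => T (e i)) = ψ.compLinearMap T ![e 0, e 1, e 2, e 3]
      + ψ.compLinearMap T ![e 0, e 1, e 4, e 5] + ψ.compLinearMap T ![e 2, e 3, e 4, e 5] := by
  have h1 : j (e 0) = e 1 ∧ j (e 1) = -e 0 ∧ j (e 2) = e 3 ∧ j (e 3) = -e 2 ∧ j (e 4) = e 5 ∧
      j (e 5) = -e 4 := by
    simp only [he.e1, he.e3, he.e5, h.sq, and_self]
  obtain ⟨j0, j1, j2, j3, j4, j5⟩ := h1
  have hT : ∀ x y z w : L, ψ ![T x, T y, T z, T w] = ψ.compLinearMap T ![x, y, z, w] := by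
    intro x y z w
    rw [AlternatingMap.compLinearMap_apply]
    congr 1
    ext i
    fin_cases i <;> rfl
  rw [wedge_apply_of_symplectic, hT, hT, hT]
  · intro i k hik
    rw [hΩ]
    revert hik
    fin_cases i <;> fin_cases k <;>
      simp [j0, j1, j2, j3, j4, j5, he.orthonormal]
  all_goals simp [hΩ, j0, j2, j4, he.orthonormal]

end InvariantStructures

end Nilmanifold

end

/-! ### The equivalence on the nilmanifold -/

theorem mainTheorem3
    {G : Type*} [Group G] [TopologicalSpace G] [ChartedSpace (EuclideanSpace ℝ (Fin 6)) G]
    [LieGroup (𝓡 6) ∞ G] [SimplyConnectedSpace G] [LieRing.IsNilpotent (GroupLieAlgebra (𝓡 6) G)]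
    (Γ : Subgroup G) [DiscreteTopology Γ]
    {M : Type*} [TopologicalSpace M] [T2Space M] [CompactSpace M]
    [ChartedSpace (EuclideanSpace ℝ (Fin 6)) M] [IsManifold (𝓡 6) ∞ M]
    (pr : G → M) (hpr : Nilmanifold.IsLeftQuotient (EuclideanSpace ℝ (Fin 6)) Γ pr)
    (J : Nilmanifold.ComplexStructure (EuclideanSpace ℝ (Fin 6)) M) (hJ : J.IsInvariant pr)
    (g : Nilmanifold.HermitianMetric (EuclideanSpace ℝ (Fin 6)) M J) (hg : g.IsInvariant pr) :
    g.IsFirstGauduchon ↔ g.IsSKT := by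
  obtain ⟨j, hj⟩ := hJ
  obtain ⟨b, hb⟩ := hg
  have h := Nilmanifold.HermitianMetric.isHermitian hpr hj hb
  have hΩ := Nilmanifold.HermitianMetric.isInduced_Omega hj hb
  have hψ := (hΩ.delbar hpr hj).del hpr hj
  constructor
  · intro hG
    funext q
    obtain ⟨a, rfl⟩ := hpr.surjective q
    have hfr : Module.finrank ℝ (GroupLieAlgebra (𝓡 6) G) = 6 :=
      finrank_euclideanSpace_fin (𝕜 := ℝ) (n := 6)
    let T := Nilmanifold.leftFieldₗ (E := EuclideanSpace ℝ (Fin 6)) pr a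
    -- The algebraic statement is applied to `∂∂̄Ω` at `pr a`, pulled back by the isomorphism `T`;
    -- the wedge hypothesis evaluated on the images of a unitary basis supplies the vanishing trace.
    have key := h.eq_zero_of_trace_eq_zero hfr
      ((J.del (J.delbar g.Omega) (pr a)).toAlternatingMap.compLinearMap T)
      (fun v => (hψ a v).trans (h.ceDel_ceDelbar_fundamental v)) fun e he => by
        rw [← h.wedge_apply he T _ (g.Omega (pr a)).toAlternatingMap, hG, AlternatingMap.zero_apply]
        intro x y
        refine Eq.trans ?_ (hΩ a ![x, y])
        refine congrArg (g.Omega (pr a)) (funext fun i => ?_)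
        fin_cases i <;> rfl
    ext v
    choose w hw using fun i => (Nilmanifold.leftFieldₗ_bijective hpr a).2 (v i)
    have := congrArg (fun Ψ => Ψ w) key
    have hv : (fun i => T (w i)) = v := funext hw
    rw [← hv]
    exact this
  · intro hS x
    have hS' : J.del (J.delbar g.Omega) = 0 := hS
    rw [hS']
    exact Nilmanifold.zero_wedge _
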